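/- \textbf{Setting (noisy phase retrieval).} Let $d,n\ge 1$ be integers. For a real random variable $X$ put $\|X\|_{\psi_2}=\inf\{t>0:\mathbb E\exp(X^2/t^2)\le 2\}$ and $\|X\|_{\psi_1}=\inf\{t>0:\mathbb E\exp(|X|/t)\le 2\}$ (with $\inf\emptyset=\infty$), and for a random vector $X$ in $\mathbb R^n$ put $\|X\|_{\psi_2}=\sup_{\|w\|_2=1}\|w^\top X\|_{\psi_2}$. Let $K,\kappa,L>0$, and let $\mathcal M$ be a probability law on $\mathbb R$ with mean zero, $\|\mathcal M\|_{\psi_2}\le K$ and $\mathbb E\mathcal M^4\ge(\mathbb E\mathcal M^2)^2+\kappa$. Let $\alpha_1,\dots,\alpha_n$ be i.i.d. random vectors in $\mathbb C^d$ such that the $2d$ real and imaginary parts of the coordinates of each $\alpha_k$ are i.i.d. with law $\mathcal M$. Let $\eta=(\eta_1,\dots,\eta_n)^\top$ be a random vector in $\mathbb R^n$ that is independent of $(\alpha_1,\dots,\alpha_n)$ and satisfies $\mathbb E\eta_k=0$ for all $k$. For $x_0\in\mathbb C^d$ set $y_k=|\alpha_k^*x_0|^2+\eta_k$, and let $\widehat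 x$ denote any global minimizer over $x\in\mathbb C^d$ of the empirical $\ell_2$ risk $\sum_{k=1}^n\big(y_k-|\alpha_k^*x|^2\big)^2$. \textbf{Theorem.} There are constants $C_1,\dots,C_5>0$, depending only on $K,\kappa,L$, such that whenever $n\ge C_1d$: (a) If $\|\eta\|_{\psi_2}\le L$ (the $\eta_k$ may be dependent), then with probability at least $1-C_3\exp(-C_4d)-2n^{-49}$, simultaneously for all $x_0\in\mathbb C^d$ and all corresponding minimizers $\widehat x$, $$\|\widehat x\widehat x^*-x_0x_0^*\|_F\le C_2\sqrt{\frac{d\log n}{n}}.$$ (b) If $\eta_1,\dots,\eta_n$ are independent and $\max_{k}\|\eta_k\|_{\psi_1}\le L$, then with probability at least $1-C_3\exp(-C_4d)-2n^{-9}$, simultaneously for all $x_0\in\mathbb C^d$ and all corresponding minimizers $\widehat x$, $$\|\widehat x\widehat x^*-x_0x_0^*\|_F\le C_5\sqrt{\frac{d(\log n)^2}{n}}.$$ -/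

import Mathlib

open MeasureTheory ProbabilityTheory
open scoped ENNReal

/-- The sub-Gaussian norm `‖X‖_{ψ₂} = inf {t > 0 : 𝔼 exp (X² / t²) ≤ 2}` of a real random
variable, with value `∞` when no such `t` exists. -/
noncomputable def psi2Norm {Ω : Type*} [MeasurableSpace Ω] (X : Ω → ℝ) (μ : Measure Ω) : ℝ≥0∞ :=
  ⨅ (t : ℝ) (_ : 0 < t ∧ ∫⁻ ω, ENNReal.ofReal (Real.exp (X ω ^ 2 / t ^ 2)) ∂μ ≤ 2),
    ENNReal.ofReal t

/-- The sub-exponential norm `‖X‖_{ψ₁} = inf {t > 0 : 𝔼 exp (|X| / t) ≤ 2}` of a real random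
variable, with value `∞` when no such `t` exists. -/
noncomputable def psi1Norm {Ω : Type*} [MeasurableSpace Ω] (X : Ω → ℝ) (μ : Measure Ω) : ℝ≥0∞ :=
  ⨅ (t : ℝ) (_ : 0 < t ∧ ∫⁻ ω, ENNReal.ofReal (Real.exp (|X ω| / t)) ∂μ ≤ 2),
    ENNReal.ofReal t

/-- The sub-Gaussian norm `sup_{‖w‖ = 1} ‖wᵀX‖_{ψ₂}` of a real random vector. -/
noncomputable def psi2NormVec {Ω : Type*} [MeasurableSpace Ω] {n : ℕ}
    (X : Ω → EuclideanSpace ℝ (Fin n)) (μ : Measure Ω) : ℝ≥0∞ :=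
  ⨆ (w : EuclideanSpace ℝ (Fin n)) (_ : ‖w‖ = 1), psi2Norm (fun ω => inner ℝ w (X ω)) μ

/-- The family of the `2d` real coordinates (real parts, then imaginary parts) of a random vector
in `ℂ^d`. -/
def realCoords {Ω : Type*} {d : ℕ} (a : Ω → EuclideanSpace ℂ (Fin d)) :
    Fin d ⊕ Fin d → Ω → ℝ :=
  Sum.elim (fun i ω => (a ω i).re) (fun i ω => (a ω i).im)

/-- `α₁, …, αₙ` are independent random vectors in `ℂ^d`, and the `2d` real coordinates of each of
them are i.i.d. with law `M` (so that the `αₖ` are i.i.d.). -/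
structure IsMeasurementEnsemble {Ω : Type*} [MeasurableSpace Ω] {d n : ℕ}
    (M : Measure ℝ) (α : Fin n → Ω → EuclideanSpace ℂ (Fin d)) (μ : Measure Ω) : Prop where
  measurable : ∀ k, Measurable (α k)
  indep : iIndepFun α μ
  indep_coords : ∀ k, iIndepFun (realCoords (α k)) μ
  law_coords : ∀ k i, μ.map (realCoords (α k) i) = M

/-- The noisy phaseless measurements `yₖ = |aₖ^* x₀|² + ηₖ`. -/
noncomputable def nprData {d n : ℕ} (a : Fin n → EuclideanSpace ℂ (Fin d))
    (x₀ : EuclideanSpace ℂ (Fin d)) (η : EuclideanSpace ℝ (Fin n)) (k : Fin n) : ℝ :=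
  ‖inner ℂ (a k) x₀‖ ^ 2 + η k

/-- The empirical `ℓ₂` loss `∑ₖ (yₖ - |aₖ^* x|²)²`. -/
noncomputable def nprLoss {d n : ℕ} (a : Fin n → EuclideanSpace ℂ (Fin d)) (y : Fin n → ℝ)
    (x : EuclideanSpace ℂ (Fin d)) : ℝ :=
  ∑ k, (y k - ‖inner ℂ (a k) x‖ ^ 2) ^ 2

/-- `x` is an ERM estimate: a global minimizer over `ℂ^d` of the empirical `ℓ₂` loss. -/
def IsERM {d n : ℕ} (a : Fin n → EuclideanSpace ℂ (Fin d)) (y : Fin n → ℝ)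
    (x : EuclideanSpace ℂ (Fin d)) : Prop :=
  ∀ z, nprLoss a y x ≤ nprLoss a y z

open scoped Matrix.Norms.Frobenius in
/-- The lifted distance `‖x x^* - z z^*‖_F`. -/
noncomputable def liftDist {d : ℕ} (x z : EuclideanSpace ℂ (Fin d)) : ℝ :=
  ‖Matrix.vecMulVec x.ofLp (star x.ofLp) - Matrix.vecMulVec z.ofLp (star z.ofLp)‖

/-- The property `P` holds with probability at least `p`: it holds on a measurable event whose
probability is at least `p` (`P` itself need not define a measurable set). -/
def HoldsWithProb {Ω : Type*} [MeasurableSpace Ω] (μ : Measure Ω) (p : ℝ) (P : Ω → Prop) : Prop :=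
  ∃ E : Set Ω, MeasurableSet E ∧ p ≤ μ.real E ∧ ∀ ω ∈ E, P ω

/-!
The proof compares the two sides of the basic inequality of least squares. Put
`Qₖ = |αₖᴴx̂|² - |αₖᴴx₀|²`. Minimality of `x̂` gives `∑ Qₖ² ≤ 2 ∑ ηₖ Qₖ`. Multiplying `x̂` by a phase
changes neither side and makes `x̂ᴴx₀` real; with `u = x̂ - x₀` and `w = x̂ + x₀` one then has
`Qₖ = Re ((αₖᴴu) conj (αₖᴴw))`, `Im (uᴴw) = 0` and `‖x̂x̂ᴴ - x₀x₀ᴴ‖ ≤ ‖u‖ ‖w‖`. It thus suffices to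
show, uniformly in `u` and `w`, that `∑ |Qₖ| ≥ c n ‖u‖ ‖w‖` and that
`|∑ ηₖ Qₖ| ≤ C √(n d) R ‖u‖ ‖w‖`, where `R` is the size of the largest noise coordinate
(`liftDist_le_of_isERM`). All of this is written in the real coordinates `rₖ ∈ ℝ²ᵈ` of `αₖ`, where
`αᴴx` has real part `pᵀr` and imaginary part `(rot p)ᵀr`.

*The lower bound.* The second moment of `Q` is bounded below by a fourth moment computation
(`IsCoordLaw.le_integral_linForm_mul_add_sq`); this is where `𝔼 M⁴ ≥ (𝔼 M²)² + κ` enters. Since the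
fourth moment of `Q` is bounded, so is `𝔼 |Q|` from below, and a one-sided tail bound for
nonnegative variables (`measureReal_sum_le_half_le`) has failure probability `exp (-c n)`. That
beats the cardinality `exp (C d)` of a net of pairs of directions. Summing `|Qₖ|` rather than `Qₖ²`
is what makes the passage from the net to all directions possible: by Cauchy-Schwarz the error is
controlled by `supₚ ∑ (pᵀrₖ)²`, which is of order `n`, whereas fourth powers would not be.

*The noise.* For fixed weights `|gₖ| ≤ R`, Bernstein's inequality and a net of the unit sphere bound
the quadratic form of `∑ gₖ (rₖrₖᵀ - 𝔼 rₖrₖᵀ)` by `C R √(n d)`; unit weights give the bound for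
`supₚ ∑ (pᵀrₖ)²`. As the noise is independent of the measurement vectors, Fubini's theorem allows
`g = η` (`exists_good_event`). The remaining multiple of `∑ ηₖ` is of order `√(n d)` by the tail of
the noise, and the largest noise coordinate is of order `√(log n)` for sub-Gaussian noise and
`log n` for sub-exponential noise, by a union bound.
-/

/-! ### Finite nets -/

open scoped Function in
/-- Volume bound: the balls of radius `ε / 2` around the points of an `ε`-separated set are
disjoint and contained in the ball of radius `1 + ε / 2`. -/
theorem card_le_of_separated_unitBall {E : Type*} [NormedAddCommGroup E] [NormedSpace ℝ E]
    [FiniteDimensional ℝ E] {ε : ℝ} (hε : 0 < ε) (s : Finset E) (hs : ∀ c ∈ s, ‖c‖ ≤ 1)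
    (h : ∀ c ∈ s, ∀ d ∈ s, c ≠ d → ε ≤ ‖c - d‖) :
    (s.card : ℝ) ≤ (1 + 2 / ε) ^ Module.finrank ℝ E := by
  borelize E
  let μ : Measure E := Measure.addHaar
  have δpos : 0 < ε / 2 := by positivity
  have ρpos : 0 < 1 + ε / 2 := by positivity
  set A := ⋃ c ∈ s, Metric.ball (c : E) (ε / 2) with hA
  have D : Set.Pairwise (s : Set E) (Disjoint on fun c => Metric.ball (c : E) (ε / 2)) := by
    rintro c hc d hd hcd
    apply Metric.ball_disjoint_ball
    rw [dist_eq_norm]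
    linarith [h c hc d hd hcd]
  have A_subset : A ⊆ Metric.ball (0 : E) (1 + ε / 2) := by
    refine Set.iUnion₂_subset fun x hx => Metric.ball_subset_ball' ?_
    rw [dist_zero_right]
    linarith [hs x hx]
  have I : (s.card : ℝ≥0∞) * ENNReal.ofReal ((ε / 2) ^ Module.finrank ℝ E) *
      μ (Metric.ball 0 1) ≤
      ENNReal.ofReal ((1 + ε / 2) ^ Module.finrank ℝ E) * μ (Metric.ball 0 1) :=
    calc
      _ = μ A := by
        rw [hA, measure_biUnion_finset D fun c _ => measurableSet_ball]
        simp only [μ.addHaar_ball_of_pos _ δpos]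
        simp only [Finset.sum_const, nsmul_eq_mul, mul_assoc]
      _ ≤ μ (Metric.ball (0 : E) (1 + ε / 2)) := measure_mono A_subset
      _ = _ := by simp only [μ.addHaar_ball_of_pos _ ρpos]
  have J := (ENNReal.mul_le_mul_iff_left (Metric.measure_ball_pos μ (0 : E) zero_lt_one).ne'
    measure_ball_lt_top.ne).1 I
  have K := ENNReal.toReal_le_of_le_ofReal (by positivity) J
  rw [ENNReal.toReal_mul, ENNReal.toReal_natCast, ENNReal.toReal_ofReal (by positivity)] at K
  rw [show 1 + 2 / ε = (1 + ε / 2) / (ε / 2) by field_simp; ring, div_pow,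
    le_div_iff₀ (by positivity)]
  exact K

theorem exists_finite_net {E : Type*} [NormedAddCommGroup E] [NormedSpace ℝ E]
    [FiniteDimensional ℝ E] {ε : ℝ} (hε : 0 < ε) (S : Set E) (hS : ∀ x ∈ S, ‖x‖ ≤ 1) :
    ∃ N : Finset E, ↑N ⊆ S ∧ (N.card : ℝ) ≤ (1 + 2 / ε) ^ Module.finrank ℝ E ∧
      ∀ x ∈ S, ∃ y ∈ N, ‖x - y‖ ≤ ε := by
  classical
  let P : Finset E → Prop := fun s => ↑s ⊆ S ∧ ∀ c ∈ s, ∀ d ∈ s, c ≠ d → ε ≤ ‖c - d‖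
  have hb : ∀ s, P s → (s.card : ℝ) ≤ (1 + 2 / ε) ^ Module.finrank ℝ E := fun s hs =>
    card_le_of_separated_unitBall hε s (fun c hc => hS c (hs.1 hc)) hs.2
  let T : Set ℕ := {k | ∃ s, P s ∧ s.card = k}
  have hT : BddAbove T := by
    refine ⟨⌊(1 + 2 / ε) ^ Module.finrank ℝ E⌋₊, ?_⟩
    rintro k ⟨s, hs, rfl⟩
    exact Nat.le_floor (hb s hs)
  have hne : T.Nonempty := ⟨0, ∅, ⟨by simp, by simp⟩, by simp⟩
  obtain ⟨N, hN, hcard⟩ := Nat.sSup_mem hne hT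
  refine ⟨N, hN.1, hb N hN, fun x hx => ?_⟩
  by_contra! hcon
  have hxN : x ∉ N := fun h => by
    have := hcon x h
    simp at this
    linarith
  -- otherwise the separated set `N` of maximal cardinality could be enlarged by `x`
  have hP : P (insert x N) := by
    refine ⟨?_, ?_⟩
    · rw [Finset.coe_insert]
      exact Set.insert_subset hx hN.1
    · intro c hc d hd hcd
      rw [Finset.mem_insert] at hc hd
      rcases hc with hc | hc <;> rcases hd with hd | hd
      · exact absurd (hc.trans hd.symm) hcd
      · rw [hc]
        exact (hcon d hd).le
      · rw [hd, norm_sub_rev]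
        exact (hcon c hc).le
      · exact hN.2 c hc d hd hcd
  have := le_csSup hT ⟨_, hP, rfl⟩
  rw [Finset.card_insert_of_notMem hxN, hcard] at this
  omega

/-! ### Exponential moments -/

theorem exp_le_one_add_add_sq_mul_exp_abs (y : ℝ) :
    Real.exp y ≤ 1 + y + y ^ 2 * Real.exp |y| := by
  have h := Complex.norm_exp_sub_sum_le_norm_mul_exp (y : ℂ) 2
  have e : Complex.exp y - ∑ m ∈ Finset.range 2, (y : ℂ) ^ m / m.factorial
      = ((Real.exp y - (1 + y) : ℝ) : ℂ) := by
    simp [Finset.sum_range_succ]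
  rw [e, Complex.norm_real, Complex.norm_real, Real.norm_eq_abs, Real.norm_eq_abs, sq_abs] at h
  linarith [le_abs_self (Real.exp y - (1 + y))]

theorem integrable_of_exp_bound {Ω : Type*} [MeasurableSpace Ω] {μ : Measure Ω} {f g : Ω → ℝ}
    (hf : AEMeasurable f μ) (C : ℝ) (hg : Integrable g μ) (h : ∀ ω, |f ω| ≤ C * g ω) :
    Integrable f μ :=
  (hg.const_mul C).mono' hf.aestronglyMeasurable (Filter.Eventually.of_forall h)

/-- The bound by `2` in the definition of the `ψ`-norms, a lower Lebesgue integral at some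
parameter, in terms of the Bochner integral at any larger parameter. -/
theorem integrable_exp_and_integral_le_two {Ω : Type*} [MeasurableSpace Ω] {μ : Measure Ω}
    {f g : Ω → ℝ} (hf : AEMeasurable f μ) (hfg : ∀ ω, f ω ≤ g ω)
    (h : ∫⁻ ω, ENNReal.ofReal (Real.exp (g ω)) ∂μ ≤ 2) :
    Integrable (fun ω => Real.exp (f ω)) μ ∧ ∫ ω, Real.exp (f ω) ∂μ ≤ 2 := by
  have hle : ∫⁻ ω, ENNReal.ofReal (Real.exp (f ω)) ∂μ ≤ 2 := by
    refine (lintegral_mono fun ω => ?_).trans h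
    exact ENNReal.ofReal_le_ofReal (Real.exp_le_exp.2 (hfg ω))
  have hi : Integrable (fun ω => Real.exp (f ω)) μ := by
    refine ⟨(Real.measurable_exp.comp_aemeasurable hf).aestronglyMeasurable, ?_⟩
    rw [hasFiniteIntegral_iff_ofReal (Filter.Eventually.of_forall fun ω => (Real.exp_pos _).le)]
    exact hle.trans_lt (by simp)
  refine ⟨hi, ?_⟩
  rw [← ofReal_integral_eq_lintegral_ofReal hi
    (Filter.Eventually.of_forall fun ω => (Real.exp_pos _).le)] at hle
  exact (ENNReal.ofReal_le_ofNat).1 hle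

theorem integrable_exp_sq_of_psi2Norm_le {Ω : Type*} [MeasurableSpace Ω] {μ : Measure Ω}
    {X : Ω → ℝ} (hX : AEMeasurable X μ) {L : ℝ} (hL : 0 < L)
    (h : psi2Norm X μ ≤ ENNReal.ofReal L) :
    Integrable (fun ω => Real.exp (X ω ^ 2 / (2 * L) ^ 2)) μ ∧
      ∫ ω, Real.exp (X ω ^ 2 / (2 * L) ^ 2) ∂μ ≤ 2 := by
  have h2 : psi2Norm X μ < ENNReal.ofReal (2 * L) :=
    h.trans_lt ((ENNReal.ofReal_lt_ofReal_iff (by positivity)).2 (by linarith))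
  simp only [psi2Norm, iInf_lt_iff] at h2
  obtain ⟨t, ⟨ht, hi⟩, hlt⟩ := h2
  have htl := (ENNReal.ofReal_lt_ofReal_iff (by positivity)).1 hlt
  refine integrable_exp_and_integral_le_two (by fun_prop) (fun ω => ?_) hi
  gcongr

theorem integrable_exp_abs_of_psi1Norm_le {Ω : Type*} [MeasurableSpace Ω] {μ : Measure Ω}
    {X : Ω → ℝ} (hX : AEMeasurable X μ) {L : ℝ} (hL : 0 < L)
    (h : psi1Norm X μ ≤ ENNReal.ofReal L) :
    Integrable (fun ω => Real.exp (|X ω| / (2 * L))) μ ∧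
      ∫ ω, Real.exp (|X ω| / (2 * L)) ∂μ ≤ 2 := by
  have h2 : psi1Norm X μ < ENNReal.ofReal (2 * L) :=
    h.trans_lt ((ENNReal.ofReal_lt_ofReal_iff (by positivity)).2 (by linarith))
  simp only [psi1Norm, iInf_lt_iff] at h2
  obtain ⟨t, ⟨ht, hi⟩, hlt⟩ := h2
  have htl := (ENNReal.ofReal_lt_ofReal_iff (by positivity)).1 hlt
  refine integrable_exp_and_integral_le_two (by fun_prop) (fun ω => ?_) hi
  gcongr

/-- A centred variable with `𝔼 exp (X² / K²) ≤ 2` has a sub-Gaussian moment generating function.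
For the bound, `exp y ≤ 1 + y + y² exp |y|` is integrated at `y = tX`, and
`|tX| ≤ t²K²/2 + X²/(2K²)`. -/
theorem hasSubgaussianMGF_of_exp_sq {Ω : Type*} [MeasurableSpace Ω] {μ : Measure Ω}
    [IsProbabilityMeasure μ] {X : Ω → ℝ} (hX : AEMeasurable X μ) {K : ℝ} (hK : 0 < K)
    (hi : Integrable (fun ω => Real.exp (X ω ^ 2 / K ^ 2)) μ)
    (h2 : ∫ ω, Real.exp (X ω ^ 2 / K ^ 2) ∂μ ≤ 2) (h0 : ∫ ω, X ω ∂μ = 0) :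
    HasSubgaussianMGF X (9 * K ^ 2).toNNReal μ := by
  have key : ∀ t ω, Real.exp |t * X ω| ≤
      Real.exp (t ^ 2 * K ^ 2 / 2) * Real.exp (X ω ^ 2 / K ^ 2 / 2) := by
    intro t ω
    rw [← Real.exp_add, Real.exp_le_exp]
    have e : (X ω ^ 2) / K ^ 2 = (X ω / K) ^ 2 := by rw [div_pow]
    have e2 : t * X ω = (t * K) * (X ω / K) := by field_simp
    rw [e, e2, abs_mul]
    nlinarith [sq_nonneg (|t * K| - |X ω / K|), sq_abs (t * K), sq_abs (X ω / K)]
  have hhalf : ∀ ω, Real.exp (X ω ^ 2 / K ^ 2 / 2) * Real.exp (X ω ^ 2 / K ^ 2 / 2)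
      = Real.exp (X ω ^ 2 / K ^ 2) := fun ω => by rw [← Real.exp_add]; ring_nf
  have hone : ∀ ω, 1 ≤ Real.exp (X ω ^ 2 / K ^ 2 / 2) := fun ω => Real.one_le_exp (by positivity)
  have hsq : ∀ ω, X ω ^ 2 ≤ 2 * K ^ 2 * Real.exp (X ω ^ 2 / K ^ 2 / 2) := by
    intro ω
    have := Real.add_one_le_exp (X ω ^ 2 / K ^ 2 / 2)
    have e : X ω ^ 2 = 2 * K ^ 2 * (X ω ^ 2 / K ^ 2 / 2) := by field_simp
    calc X ω ^ 2 = 2 * K ^ 2 * (X ω ^ 2 / K ^ 2 / 2) := e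
      _ ≤ _ := by gcongr; linarith
  have hbase : ∀ t ω, Real.exp |t * X ω| ≤
      Real.exp (t ^ 2 * K ^ 2 / 2) * Real.exp (X ω ^ 2 / K ^ 2) := by
    intro t ω
    refine (key t ω).trans ?_
    rw [← hhalf ω]
    gcongr
    nlinarith [hone ω]
  have hint : ∀ t, Integrable (fun ω => Real.exp (t * X ω)) μ := by
    intro t
    refine integrable_of_exp_bound (by fun_prop) (Real.exp (t ^ 2 * K ^ 2 / 2)) hi fun ω => ?_
    rw [abs_of_pos (Real.exp_pos _)]
    exact (Real.exp_le_exp.2 (le_abs_self _)).trans (hbase t ω)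
  have hXi : Integrable X μ := by
    refine integrable_of_exp_bound hX (Real.exp (1 ^ 2 * K ^ 2 / 2)) hi fun ω => ?_
    have := hbase 1 ω
    rw [one_mul] at this
    linarith [Real.add_one_le_exp |X ω|]
  refine ⟨hint, fun t => ?_⟩
  have hpt : ∀ ω, Real.exp (t * X ω) ≤ 1 + t * X ω +
      2 * K ^ 2 * t ^ 2 * Real.exp (t ^ 2 * K ^ 2 / 2) * Real.exp (X ω ^ 2 / K ^ 2) := by
    intro ω
    have h1 := exp_le_one_add_add_sq_mul_exp_abs (t * X ω)
    have h3 : (t * X ω) ^ 2 * Real.exp |t * X ω| ≤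
        (t ^ 2 * (2 * K ^ 2 * Real.exp (X ω ^ 2 / K ^ 2 / 2))) *
        (Real.exp (t ^ 2 * K ^ 2 / 2) * Real.exp (X ω ^ 2 / K ^ 2 / 2)) := by
      rw [mul_pow]
      gcongr
      · exact hsq ω
      · exact key t ω
    rw [← hhalf ω]
    linarith
  have hI : mgf X μ t ≤ 1 + 2 * K ^ 2 * t ^ 2 * Real.exp (t ^ 2 * K ^ 2 / 2) * 2 := by
    have i1 : Integrable (fun ω => 1 + t * X ω) μ := (integrable_const _).add (hXi.const_mul t)
    have := integral_mono (hint t) (i1.add (hi.const_mul _)) hpt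
    simp only [Pi.add_apply] at this
    rw [integral_add i1 (hi.const_mul _), integral_add (integrable_const _) (hXi.const_mul t),
      integral_const_mul, integral_const_mul, h0] at this
    simp at this
    refine this.trans ?_
    gcongr
  refine hI.trans ?_
  have e1 : ((9 * K ^ 2).toNNReal : ℝ) * t ^ 2 / 2
      = t ^ 2 * K ^ 2 / 2 + 4 * (t ^ 2 * K ^ 2) := by
    rw [Real.coe_toNNReal _ (by positivity)]
    ring
  rw [e1, Real.exp_add]
  have h5 := Real.add_one_le_exp (4 * (t ^ 2 * K ^ 2))
  have h6 : 1 ≤ Real.exp (t ^ 2 * K ^ 2 / 2) := Real.one_le_exp (by positivity)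
  nlinarith [mul_le_mul_of_nonneg_left h5 (Real.exp_pos (t ^ 2 * K ^ 2 / 2)).le]

/-- The exponential square moment `𝔼 exp (g² / 4)` of a standard Gaussian variable `g`. -/
noncomputable def gaussExpSq : ℝ := ∫ g, Real.exp (g ^ 2 / 4) ∂(gaussianReal 0 1)

theorem integrable_exp_sq_gaussianReal :
    Integrable (fun g : ℝ => Real.exp (g ^ 2 / 4)) (gaussianReal 0 1) := by
  rw [gaussianReal_of_var_ne_zero _ one_ne_zero, gaussianPDF_def,
    integrable_withDensity_iff_integrable_smul₀' (by fun_prop) (by simp)]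
  have h := (integrable_exp_neg_mul_sq (b := 1 / 4) (by norm_num)).const_mul (√(2 * Real.pi))⁻¹
  refine h.congr (Filter.Eventually.of_forall fun x => ?_)
  simp only [smul_eq_mul]
  rw [ENNReal.toReal_ofReal (gaussianPDFReal_nonneg _ _ _), gaussianPDFReal, mul_assoc,
    ← Real.exp_add]
  simp only [NNReal.coe_one, mul_one, sub_zero]
  ring_nf

theorem one_le_gaussExpSq : 1 ≤ gaussExpSq := by
  have := integral_mono (integrable_const (1 : ℝ)) integrable_exp_sq_gaussianReal
    (fun g => Real.one_le_exp (by positivity))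
  simpa [gaussExpSq] using this

/-- Gaussian linearisation: `exp (X² / (4c))` is the Gaussian average of `exp (g X / √(2c))`,
whose expectation is controlled by the moment generating function of `X`. -/
theorem ProbabilityTheory.HasSubgaussianMGF.integrable_exp_sq {Ω : Type*} [MeasurableSpace Ω]
    {μ : Measure Ω} [IsProbabilityMeasure μ] {X : Ω → ℝ} {c : NNReal} (hc : 0 < c)
    (h : HasSubgaussianMGF X c μ) :
    Integrable (fun ω => Real.exp (X ω ^ 2 / (4 * c))) μ ∧
      ∫ ω, Real.exp (X ω ^ 2 / (4 * c)) ∂μ ≤ gaussExpSq := by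
  have hX : AEMeasurable X μ := h.aemeasurable
  have hc' : (0 : ℝ) < c := hc
  set s : ℝ := (√(2 * c))⁻¹ with hs
  have hs2 : s ^ 2 = 1 / (2 * c) := by
    rw [hs, inv_pow, Real.sq_sqrt (by positivity), one_div]
  have h1 : ∀ ω, ENNReal.ofReal (Real.exp (X ω ^ 2 / (4 * c))) =
      ∫⁻ g, ENNReal.ofReal (Real.exp (s * X ω * g)) ∂(gaussianReal 0 1) := by
    intro ω
    rw [← ofReal_integral_eq_lintegral_ofReal (integrable_exp_mul_gaussianReal _)
      (Filter.Eventually.of_forall fun g => (Real.exp_pos _).le)]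
    have := congrFun (mgf_fun_id_gaussianReal (μ := 0) (v := 1)) (s * X ω)
    rw [mgf] at this
    rw [this]
    congr 2
    rw [mul_pow, hs2]
    simp
    field_simp
    ring
  have h2 : ∫⁻ ω, ENNReal.ofReal (Real.exp (X ω ^ 2 / (4 * c))) ∂μ
      ≤ ENNReal.ofReal gaussExpSq := by
    simp_rw [h1]
    rw [lintegral_lintegral_swap]
    · rw [gaussExpSq, ofReal_integral_eq_lintegral_ofReal integrable_exp_sq_gaussianReal
        (Filter.Eventually.of_forall fun g => (Real.exp_pos _).le)]
      refine lintegral_mono fun g => ?_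
      have e : ∀ ω, s * X ω * g = (s * g) * X ω := fun ω => by ring
      simp_rw [e]
      rw [← ofReal_integral_eq_lintegral_ofReal (h.integrable_exp_mul _)
        (Filter.Eventually.of_forall fun g => (Real.exp_pos _).le)]
      refine ENNReal.ofReal_le_ofReal ((h.mgf_le (s * g)).trans_eq ?_)
      rw [mul_pow, hs2]
      field_simp
      ring_nf
    · have : AEMeasurable (fun p : Ω × ℝ => X p.1) (μ.prod (gaussianReal 0 1)) :=
        hX.comp_quasiMeasurePreserving Measure.quasiMeasurePreserving_fst
      simp only [Function.uncurry_def]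
      fun_prop
  have hi : Integrable (fun ω => Real.exp (X ω ^ 2 / (4 * c))) μ := by
    refine ⟨by fun_prop, ?_⟩
    rw [hasFiniteIntegral_iff_ofReal (Filter.Eventually.of_forall fun ω => (Real.exp_pos _).le)]
    exact h2.trans_lt ENNReal.ofReal_lt_top
  refine ⟨hi, ?_⟩
  rw [← ofReal_integral_eq_lintegral_ofReal hi
    (Filter.Eventually.of_forall fun ω => (Real.exp_pos _).le)] at h2
  exact (ENNReal.ofReal_le_ofReal_iff (zero_le_one.trans one_le_gaussExpSq)).1 h2

/-- The one-variable bound behind Bernstein's inequality. -/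
theorem mgf_le_of_exp_abs {Ω : Type*} [MeasurableSpace Ω] {μ : Measure Ω}
    [IsProbabilityMeasure μ] {X : Ω → ℝ} (hX : AEMeasurable X μ) {b B : ℝ} (hb : 0 < b)
    (hi : Integrable (fun ω => Real.exp (|X ω| / b)) μ)
    (hB : ∫ ω, Real.exp (|X ω| / b) ∂μ ≤ B) (h0 : ∫ ω, X ω ∂μ = 0) {t : ℝ}
    (ht : |t| ≤ 1 / (2 * b)) :
    Integrable (fun ω => Real.exp (t * X ω)) μ ∧
      mgf X μ t ≤ Real.exp (8 * B * b ^ 2 * t ^ 2) := by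
  have hht : ∀ ω, |t * X ω| ≤ |X ω| / b / 2 := fun ω => by
    rw [abs_mul]
    calc |t| * |X ω| ≤ 1 / (2 * b) * |X ω| := by gcongr
      _ = _ := by field_simp
  have hhalf : ∀ ω, Real.exp (|X ω| / b / 2) * Real.exp (|X ω| / b / 2)
      = Real.exp (|X ω| / b) := fun ω => by rw [← Real.exp_add]; ring_nf
  have hint : Integrable (fun ω => Real.exp (t * X ω)) μ := by
    refine integrable_of_exp_bound (by fun_prop) 1 hi fun ω => ?_
    rw [abs_of_pos (Real.exp_pos _), one_mul, Real.exp_le_exp]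
    have : 0 ≤ |X ω| / b := by positivity
    linarith [le_abs_self (t * X ω), hht ω]
  have hXi : Integrable X μ := by
    refine integrable_of_exp_bound hX b hi fun ω => ?_
    have h1 := Real.add_one_le_exp (|X ω| / b)
    calc |X ω| = b * (|X ω| / b) := by field_simp
      _ ≤ _ := by gcongr; linarith
  refine ⟨hint, ?_⟩
  have hpt : ∀ ω, Real.exp (t * X ω) ≤ 1 + t * X ω +
      8 * b ^ 2 * t ^ 2 * Real.exp (|X ω| / b) := by
    intro ω
    have h1 := exp_le_one_add_add_sq_mul_exp_abs (t * X ω)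
    have hsq : X ω ^ 2 ≤ 8 * b ^ 2 * Real.exp (|X ω| / b / 2) := by
      have hq := Real.quadratic_le_exp_of_nonneg (x := |X ω| / b / 2) (by positivity)
      have hp : 0 ≤ |X ω| / b / 2 := by positivity
      have e : X ω ^ 2 = 8 * b ^ 2 * ((|X ω| / b / 2) ^ 2 / 2) := by
        rw [div_pow, div_pow, sq_abs]; field_simp; norm_num
      rw [e]
      gcongr
      linarith
    have h3 : (t * X ω) ^ 2 * Real.exp |t * X ω| ≤
        (t ^ 2 * (8 * b ^ 2 * Real.exp (|X ω| / b / 2))) * Real.exp (|X ω| / b / 2) := by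
      rw [mul_pow]
      gcongr
      exact hht ω
    rw [← hhalf ω]
    linarith
  have i1 : Integrable (fun ω => 1 + t * X ω) μ := (integrable_const _).add (hXi.const_mul t)
  have := integral_mono hint (i1.add (hi.const_mul _)) hpt
  simp only [Pi.add_apply] at this
  rw [integral_add i1 (hi.const_mul _), integral_add (integrable_const _) (hXi.const_mul t),
    integral_const_mul, integral_const_mul, h0] at this
  simp at this
  calc mgf X μ t ≤ 1 + 8 * b ^ 2 * t ^ 2 * ∫ ω, Real.exp (|X ω| / b) ∂μ := this
    _ ≤ 1 + 8 * b ^ 2 * t ^ 2 * B := by gcongr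
    _ ≤ _ := by
      have := Real.add_one_le_exp (8 * B * b ^ 2 * t ^ 2)
      linarith

/-! ### Tail bounds for sums of independent variables -/

theorem measureReal_sum_ge_le {Ω : Type*} [MeasurableSpace Ω] {μ : Measure Ω}
    [IsProbabilityMeasure μ] {n : ℕ} {X : Fin n → Ω → ℝ} (hind : iIndepFun X μ)
    (hm : ∀ k, Measurable (X k)) {t v : ℝ} (ht : 0 ≤ t)
    (h : ∀ k, Integrable (fun ω => Real.exp (t * X k ω)) μ ∧ mgf (X k) μ t ≤ Real.exp v) (ε : ℝ) :
    μ.real {ω | ε ≤ ∑ k, X k ω} ≤ Real.exp (-t * ε + n * v) := by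
  have hi := hind.integrable_exp_mul_sum hm (s := Finset.univ) (fun k _ => (h k).1)
  have h1 := measure_ge_le_exp_mul_mgf ε ht hi
  rw [hind.mgf_sum hm] at h1
  simp only [Finset.sum_apply] at h1
  refine h1.trans ?_
  rw [Real.exp_add]
  gcongr
  calc ∏ k, mgf (X k) μ t ≤ ∏ _k : Fin n, Real.exp v :=
        Finset.prod_le_prod (fun k _ => mgf_nonneg) (fun k _ => (h k).2)
    _ = Real.exp (n * v) := by simp [Real.exp_nat_mul]

/-- **Bernstein's inequality** for weighted sums at the deviation `A R √(n m)` with `m ≤ n`, where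
only the Gaussian part of the tail is visible. -/
theorem measureReal_abs_weighted_sum_gt_le {Ω : Type*} [MeasurableSpace Ω] {μ : Measure Ω}
    [IsProbabilityMeasure μ] {n : ℕ} (hn : 0 < n) {X : Fin n → Ω → ℝ} (hind : iIndepFun X μ)
    (hm : ∀ k, Measurable (X k)) {b B : ℝ} (hb : 0 < b)
    (hi : ∀ k, Integrable (fun ω => Real.exp (|X k ω| / b)) μ)
    (hB : ∀ k, ∫ ω, Real.exp (|X k ω| / b) ∂μ ≤ B) (h0 : ∀ k, ∫ ω, X k ω ∂μ = 0)
    {h : Fin n → ℝ} {R : ℝ} (hR : 0 < R) (hh : ∀ k, |h k| ≤ R) {m : ℝ} (hm0 : 0 ≤ m)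
    (hmn : m ≤ n) (A : ℝ) :
    μ.real {ω | A * R * √(n * m) < |∑ k, h k * X k ω|}
      ≤ 2 * Real.exp (-(A / (2 * b) - 2 * B) * m) := by
  have hn' : (0 : ℝ) < n := by exact_mod_cast hn
  have hBn : 0 ≤ B := le_trans (integral_nonneg fun ω => (Real.exp_pos _).le) (hB ⟨0, hn⟩)
  set t : ℝ := √(m / n) / (2 * b * R) with htdef
  have ht0 : 0 ≤ t := by positivity
  have htR : t * R ≤ 1 / (2 * b) := by
    have : √(m / n) ≤ 1 := Real.sqrt_le_one.2 ((div_le_one hn').2 hmn)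
    rw [htdef]
    calc √(m / n) / (2 * b * R) * R = √(m / n) / (2 * b) := by field_simp
      _ ≤ _ := by gcongr
  have ht2 : (t * R) ^ 2 * n = m / (4 * b ^ 2) := by
    rw [htdef, show √(m / n) / (2 * b * R) * R = √(m / n) / (2 * b) by field_simp, div_pow,
      Real.sq_sqrt (by positivity)]
    field_simp
    ring
  have htm : t * (A * R * √(n * m)) = A / (2 * b) * m := by
    have : √(m / n) * √(n * m) = m := by
      rw [← Real.sqrt_mul (by positivity), show m / n * (n * m) = m ^ 2 by field_simp,
        Real.sqrt_sq hm0]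
    calc t * (A * R * √(n * m)) = A / (2 * b) * (√(m / n) * √(n * m)) := by
          rw [htdef]; field_simp
      _ = _ := by rw [this]
  have one : ∀ g : Fin n → ℝ, (∀ k, |g k| ≤ R) →
      μ.real {ω | A * R * √(n * m) ≤ ∑ k, g k * X k ω} ≤
        Real.exp (-(A / (2 * b) - 2 * B) * m) := by
    intro g hg
    have hind' : iIndepFun (fun k ω => g k * X k ω) μ :=
      hind.comp (fun k x => g k * x) (fun k => by fun_prop)
    have hk : ∀ k, Integrable (fun ω => Real.exp (t * (g k * X k ω))) μ ∧
        mgf (fun ω => g k * X k ω) μ t ≤ Real.exp (8 * B * b ^ 2 * (t * R) ^ 2) := by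
      intro k
      have habs : |t * g k| ≤ t * R := by
        rw [abs_mul, abs_of_nonneg ht0]
        gcongr
        exact hg k
      obtain ⟨i1, i2⟩ := mgf_le_of_exp_abs (hm k).aemeasurable hb (hi k) (hB k) (h0 k)
        (habs.trans htR)
      simp only [mgf, ← mul_assoc] at i1 i2 ⊢
      refine ⟨i1, i2.trans ?_⟩
      have hsq : (t * g k) ^ 2 ≤ (t * R) ^ 2 := sq_le_sq.2 (habs.trans (le_abs_self _))
      gcongr
    have := measureReal_sum_ge_le hind' (fun k => by fun_prop) ht0 hk (A * R * √(n * m))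
    refine this.trans_eq ?_
    congr 1
    rw [neg_mul, htm]
    calc -(A / (2 * b) * m) + n * (8 * B * b ^ 2 * (t * R) ^ 2)
        = -(A / (2 * b) * m) + 8 * B * b ^ 2 * ((t * R) ^ 2 * n) := by ring
      _ = _ := by rw [ht2]; field_simp; ring
  have hsub : {ω | A * R * √(n * m) < |∑ k, h k * X k ω|} ⊆
      {ω | A * R * √(n * m) ≤ ∑ k, h k * X k ω} ∪
      {ω | A * R * √(n * m) ≤ ∑ k, (-h k) * X k ω} := by
    intro ω hω
    simp only [neg_mul, Finset.sum_neg_distrib]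
    rw [Set.mem_ofPred_eq] at hω
    rcases lt_abs.1 hω with h | h
    · exact Or.inl h.le
    · exact Or.inr h.le
  calc _ ≤ _ := measureReal_mono hsub
    _ ≤ _ := measureReal_union_le _ _
    _ ≤ _ := by
      have a := one h hh
      have b := one (fun k => -h k) (fun k => by rw [abs_neg]; exact hh k)
      linarith

theorem exp_neg_le_one_sub_add_sq_div_two {x : ℝ} (hx : 0 ≤ x) :
    Real.exp (-x) ≤ 1 - x + x ^ 2 / 2 := by
  have h := Real.quadratic_le_exp_of_nonneg hx
  rw [Real.exp_neg, inv_le_iff_one_le_mul₀ (Real.exp_pos x)]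
  have h2 : 0 ≤ 1 - x + x ^ 2 / 2 := by nlinarith [sq_nonneg (x - 1)]
  nlinarith [mul_le_mul_of_nonneg_left h h2, sq_nonneg (x ^ 2)]

/-- A sum of independent nonnegative variables with means at least `c` is rarely below half of
`c n`; only second moments are needed for this one-sided bound. -/
theorem measureReal_sum_le_half_le {Ω : Type*} [MeasurableSpace Ω] {μ : Measure Ω}
    [IsProbabilityMeasure μ] {n : ℕ} {Y : Fin n → Ω → ℝ} (hind : iIndepFun Y μ)
    (hm : ∀ k, Measurable (Y k)) (hpos : ∀ k ω, 0 ≤ Y k ω) {c C : ℝ} (hc : 0 < c) (hC : 0 < C)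
    (hi : ∀ k, Integrable (Y k) μ) (hi2 : ∀ k, Integrable (fun ω => Y k ω ^ 2) μ)
    (hmean : ∀ k, c ≤ ∫ ω, Y k ω ∂μ) (hsq : ∀ k, ∫ ω, Y k ω ^ 2 ∂μ ≤ C) :
    μ.real {ω | ∑ k, Y k ω ≤ n * (c / 2)} ≤ Real.exp (-(c ^ 2 / (8 * C)) * n) := by
  set l : ℝ := c / (2 * C) with hl
  have hl0 : 0 ≤ l := by positivity
  have hind' : iIndepFun (fun k ω => -Y k ω) μ := hind.comp (fun k x => -x) (fun k => by fun_prop)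
  have hk : ∀ k, Integrable (fun ω => Real.exp (l * (-Y k ω))) μ ∧
      mgf (fun ω => -Y k ω) μ l ≤ Real.exp (-l * c + l ^ 2 * C / 2) := by
    intro k
    have i1 : Integrable (fun ω => Real.exp (l * (-Y k ω))) μ := by
      refine Integrable.mono' (integrable_const (1 : ℝ)) ?_
        (Filter.Eventually.of_forall fun ω => ?_)
      · have := hm k
        fun_prop
      · rw [Real.norm_eq_abs, abs_of_pos (Real.exp_pos _), Real.exp_le_one_iff]
        nlinarith [mul_nonneg hl0 (hpos k ω)]
    refine ⟨i1, ?_⟩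
    have i2 : Integrable (fun ω => 1 - l * Y k ω) μ := (integrable_const _).sub ((hi k).const_mul l)
    have i3 : Integrable (fun ω => l ^ 2 / 2 * Y k ω ^ 2) μ := (hi2 k).const_mul _
    have := integral_mono i1 (i2.add i3) (fun ω => by
      have := exp_neg_le_one_sub_add_sq_div_two (mul_nonneg hl0 (hpos k ω))
      simp only [Pi.add_apply, mul_neg]
      refine this.trans_eq ?_
      ring)
    simp only [Pi.add_apply] at this
    rw [integral_add i2 i3, integral_sub (integrable_const _) ((hi k).const_mul l),
      integral_const_mul, integral_const_mul] at this
    simp at this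
    have h1 : mgf (fun ω => -Y k ω) μ l = ∫ ω, Real.exp (-(l * Y k ω)) ∂μ := by
      simp [mgf]
    rw [h1]
    have h2 := Real.add_one_le_exp (-l * c + l ^ 2 * C / 2)
    have h3 := mul_le_mul_of_nonneg_left (hmean k) hl0
    have h4 := mul_le_mul_of_nonneg_left (hsq k) (show 0 ≤ l ^ 2 / 2 by positivity)
    linarith
  have := measureReal_sum_ge_le hind' (fun k => by have := hm k; fun_prop) hl0 hk (-(n * (c / 2)))
  simp only [Finset.sum_neg_distrib, neg_le_neg_iff] at this
  refine this.trans_eq ?_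
  congr 1
  rw [hl]
  field_simp
  ring

/-! ### Linear and quadratic forms in independent coordinates -/

/-- The conditions on the law of the coordinates of the measurement vectors; the sub-Gaussian
condition is expressed by an exponential square moment. -/
structure IsCoordLaw (M : Measure ℝ) (K κ : ℝ) : Prop where
  K_pos : 0 < K
  κ_pos : 0 < κ
  mean : ∫ x, x ∂M = 0
  integrable_exp : Integrable (fun x => Real.exp (x ^ 2 / K ^ 2)) M
  integral_exp : ∫ x, Real.exp (x ^ 2 / K ^ 2) ∂M ≤ 2
  kurtosis : (∫ x, x ^ 2 ∂M) ^ 2 + κ ≤ ∫ x, x ^ 4 ∂M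

/-- The linear form `r ↦ pᵀ r`. -/
noncomputable def linForm {ι : Type*} [Fintype ι] (p : EuclideanSpace ℝ ι) (r : ι → ℝ) : ℝ :=
  ∑ i, p i * r i

section

variable {ι : Type*} [Fintype ι]

theorem linForm_add (p q : EuclideanSpace ℝ ι) (r : ι → ℝ) :
    linForm (p + q) r = linForm p r + linForm q r := by
  simp [linForm, add_mul, Finset.sum_add_distrib]

theorem linForm_sub (p q : EuclideanSpace ℝ ι) (r : ι → ℝ) :
    linForm (p - q) r = linForm p r - linForm q r := by
  simp [linForm, sub_mul, Finset.sum_sub_distrib]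

theorem linForm_smul (a : ℝ) (p : EuclideanSpace ℝ ι) (r : ι → ℝ) :
    linForm (a • p) r = a * linForm p r := by
  simp [linForm, mul_assoc, Finset.mul_sum]

@[fun_prop]
theorem measurable_linForm (p : EuclideanSpace ℝ ι) : Measurable (linForm p) := by
  unfold linForm
  fun_prop

@[fun_prop]
theorem continuous_linForm_left (r : ι → ℝ) :
    Continuous (fun p : EuclideanSpace ℝ ι => linForm p r) := by
  unfold linForm
  fun_prop

end

namespace IsCoordLaw

variable {M : Measure ℝ} [IsProbabilityMeasure M] {K κ : ℝ}

theorem hasSubgaussianMGF (h : IsCoordLaw M K κ) :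
    HasSubgaussianMGF (fun x : ℝ => x) (9 * K ^ 2).toNNReal M :=
  hasSubgaussianMGF_of_exp_sq (by fun_prop) h.K_pos h.integrable_exp h.integral_exp h.mean

theorem integrable_pow (h : IsCoordLaw M K κ) (k : ℕ) : Integrable (fun x : ℝ => x ^ k) M := by
  have := h.hasSubgaussianMGF
  exact integrable_pow_of_mem_interior_integrableExpSet
    (by rw [this.integrableExpSet_eq_univ]; simp) k

theorem integral_sq_le (h : IsCoordLaw M K κ) : ∫ x, x ^ 2 ∂M ≤ K ^ 2 := by
  have hK := h.K_pos
  have := integral_mono (h.integrable_pow 2)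
    ((h.integrable_exp.sub (integrable_const 1)).const_mul (K ^ 2)) (fun x => by
      have h1 := Real.add_one_le_exp (x ^ 2 / K ^ 2)
      calc x ^ 2 = K ^ 2 * (x ^ 2 / K ^ 2) := by field_simp
        _ ≤ K ^ 2 * (Real.exp (x ^ 2 / K ^ 2) - 1) := by gcongr; linarith)
  rw [integral_const_mul, integral_sub' h.integrable_exp (integrable_const 1)] at this
  simp at this
  nlinarith [h.integral_exp, sq_nonneg K]

/-- The fourth moment cannot be large compared with the variance, because
`x⁴ ≤ T² x² + x⁶ / T²`; a lower bound for the fourth moment thus gives one for the variance. -/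
theorem le_integral_sq (h : IsCoordLaw M K κ) : κ ^ 2 / (48 * K ^ 6) ≤ ∫ x, x ^ 2 ∂M := by
  have hK := h.K_pos
  have hκ := h.κ_pos
  have h6 : ∫ x, x ^ 6 ∂M ≤ 12 * K ^ 6 := by
    have := integral_mono (h.integrable_pow 6) (h.integrable_exp.const_mul (6 * K ^ 6))
      (fun x => by
        have h1 := Real.pow_div_factorial_le_exp (x ^ 2 / K ^ 2) (by positivity) 3
        have e : x ^ 6 = 6 * K ^ 6 * ((x ^ 2 / K ^ 2) ^ 3 / (Nat.factorial 3 : ℝ)) := by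
          simp [Nat.factorial]; field_simp
        simp only
        rw [e]
        gcongr)
    rw [integral_const_mul] at this
    nlinarith [h.integral_exp, pow_pos hK 6]
  set U : ℝ := 24 * K ^ 6 / κ with hU
  have hUpos : 0 < U := by positivity
  have h4 := integral_mono (h.integrable_pow 4)
      (((h.integrable_pow 2).const_mul U).add ((h.integrable_pow 6).const_mul (1 / U)))
      (fun x => by
        simp only [Pi.add_apply]
        have h1 : U * x ^ 2 + 1 / U * x ^ 6 - x ^ 4 =
          x ^ 2 / U * ((U - x ^ 2 / 2) ^ 2 + 3 / 4 * x ^ 4) := by field_simp; ring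
        have h2 : 0 ≤ x ^ 2 / U * ((U - x ^ 2 / 2) ^ 2 + 3 / 4 * x ^ 4) := by positivity
        linarith)
  simp only [Pi.add_apply] at h4
  rw [integral_add ((h.integrable_pow 2).const_mul U) ((h.integrable_pow 6).const_mul (1 / U)),
    integral_const_mul, integral_const_mul] at h4
  have h5 : 1 / U * ∫ x, x ^ 6 ∂M ≤ κ / 2 := by
    calc 1 / U * ∫ x, x ^ 6 ∂M ≤ 1 / U * (12 * K ^ 6) := by gcongr
      _ = κ / 2 := by rw [hU]; field_simp; norm_num
  have h7 : κ / 2 ≤ U * ∫ x, x ^ 2 ∂M := by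
    nlinarith [h.kurtosis, sq_nonneg (∫ x, x ^ 2 ∂M)]
  calc κ ^ 2 / (48 * K ^ 6) = κ / 2 / U := by rw [hU]; field_simp; norm_num
    _ ≤ _ := by rw [div_le_iff₀ hUpos]; linarith

variable {ι : Type*} [Fintype ι]

theorem integral_pi_monomial (h : IsCoordLaw M K κ) (c : ι → ℕ) :
    Integrable (fun r : ι → ℝ => ∏ a, r a ^ c a) (Measure.pi fun _ => M) ∧
    ∫ r, ∏ a, r a ^ c a ∂(Measure.pi fun _ : ι => M) = ∏ a, ∫ x, x ^ c a ∂M :=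
  ⟨Integrable.fintype_prod (f := fun a (x : ℝ) => x ^ c a) (fun _ => h.integrable_pow _),
    integral_fintype_prod_eq_prod (fun a (x : ℝ) => x ^ c a)⟩

theorem integral_pi_mul (h : IsCoordLaw M K κ) [DecidableEq ι] (i j : ι) :
    Integrable (fun r : ι → ℝ => r i * r j) (Measure.pi fun _ => M) ∧
    ∫ r, r i * r j ∂(Measure.pi fun _ : ι => M) = if i = j then ∫ x, x ^ 2 ∂M else 0 := by
  have e : ∀ r : ι → ℝ, r i * r j =
      ∏ a, r a ^ ((if i = a then 1 else 0) + (if j = a then 1 else 0)) := by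
    intro r
    simp only [pow_add, Finset.prod_mul_distrib, Finset.prod_pow_boole, Finset.mem_univ, if_true]
  simp_rw [e]
  refine ⟨(h.integral_pi_monomial _).1, ?_⟩
  rw [(h.integral_pi_monomial _).2]
  by_cases hij : i = j
  · subst hij
    rw [Finset.prod_eq_single i]
    · simp
    · intro b _ hb
      simp [hb.symm]
    · simp
  · rw [Finset.prod_eq_zero (Finset.mem_univ i)]
    · simp [hij]
    · simp [Ne.symm hij, h.mean]

theorem integral_pi_mul_mul_mul (h : IsCoordLaw M K κ) [DecidableEq ι] (i j k l : ι) :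
    Integrable (fun r : ι → ℝ => r i * r j * r k * r l) (Measure.pi fun _ => M) ∧
    ∫ r, r i * r j * r k * r l ∂(Measure.pi fun _ : ι => M) =
      (∫ x, x ^ 2 ∂M) ^ 2 * ((if i = j then 1 else 0) * (if k = l then 1 else 0)
        + (if i = k then 1 else 0) * (if j = l then 1 else 0)
        + (if i = l then 1 else 0) * (if j = k then 1 else 0))
      + (∫ x, x ^ 4 ∂M - 3 * (∫ x, x ^ 2 ∂M) ^ 2) *
        ((if i = j then 1 else 0) * (if k = l then 1 else 0) * (if i = k then 1 else 0)) := by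
  have e : ∀ r : ι → ℝ, r i * r j * r k * r l =
      ∏ a, r a ^ ((if i = a then 1 else 0) + (if j = a then 1 else 0)
        + (if k = a then 1 else 0) + (if l = a then 1 else 0)) := by
    intro r
    simp only [pow_add, Finset.prod_mul_distrib, Finset.prod_pow_boole, Finset.mem_univ, if_true]
  simp_rw [e]
  refine ⟨(h.integral_pi_monomial _).1, ?_⟩
  rw [(h.integral_pi_monomial _).2]
  -- an index that occurs exactly once contributes the factor `∫ x ∂M = 0`
  have once : ∀ x : ι, ((if i = x then 1 else 0) + (if j = x then 1 else 0)
      + (if k = x then 1 else 0) + (if l = x then 1 else 0)) = 1 →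
      ∏ a, ∫ y, y ^ ((if i = a then 1 else 0) + (if j = a then 1 else 0)
        + (if k = a then 1 else 0) + (if l = a then 1 else 0)) ∂M = 0 := by
    intro x hx
    refine Finset.prod_eq_zero (Finset.mem_univ x) ?_
    simp only [hx, pow_one, h.mean]
  have pair : ∀ x y : ι, x ≠ y → (∀ a, ((if i = a then 1 else 0) + (if j = a then 1 else 0)
      + (if k = a then 1 else 0) + (if l = a then 1 else 0)) =
        if a = x ∨ a = y then 2 else 0) →
      ∏ a, ∫ y, y ^ ((if i = a then 1 else 0) + (if j = a then 1 else 0)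
        + (if k = a then 1 else 0) + (if l = a then 1 else 0)) ∂M
        = (∫ x, x ^ 2 ∂M) ^ 2 := by
    intro x y hxy hc
    simp only [hc]
    rw [Finset.prod_eq_mul x y hxy]
    · simp [sq]
    · intro c _ hcc
      simp [hcc.1, hcc.2]
    · simp
    · simp
  by_cases hij : i = j
  · subst hij
    by_cases hkl : k = l
    · subst hkl
      by_cases hik : i = k
      · subst hik
        rw [Finset.prod_eq_single i]
        · simp
          ring
        · intro b _ hb
          simp [hb.symm]
        · simp
      · rw [pair i k hik (fun a => by grind)]
        simp [hik]
    · by_cases hik : i = k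
      · subst hik
        rw [once l (by grind)]
        simp [hkl]
      · rw [once k (by grind)]
        simp [hkl, hik]
  · by_cases hik : i = k
    · subst hik
      by_cases hjl : j = l
      · subst hjl
        rw [pair i j hij (fun a => by grind)]
        simp [hij]
      · rw [once j (by grind)]
        simp [hij, hjl, Ne.symm hij]
    · by_cases hil : i = l
      · subst hil
        by_cases hjk : j = k
        · subst hjk
          rw [pair i j hij (fun a => by grind)]
          simp [hij]
        · rw [once j (by grind)]
          simp [hij, hik, hjk]
      · rw [once i (by grind)]
        simp [hij, hik, hil]

theorem integral_linForm_sq (h : IsCoordLaw M K κ) (p : EuclideanSpace ℝ ι) :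
    ∫ r, linForm p r ^ 2 ∂(Measure.pi fun _ : ι => M) = (∫ x, x ^ 2 ∂M) * ‖p‖ ^ 2 := by
  classical
  have e : ∀ r : ι → ℝ, linForm p r ^ 2 = ∑ i, ∑ j, p i * p j * (r i * r j) := by
    intro r
    rw [sq, linForm, Finset.sum_mul_sum]
    exact Finset.sum_congr rfl fun i _ => Finset.sum_congr rfl fun j _ => by ring
  simp_rw [e]
  rw [integral_finsetSum _ fun i _ => integrable_finsetSum _ fun j _ =>
    (h.integral_pi_mul i j).1.const_mul _]
  simp_rw [integral_finsetSum Finset.univ fun j _ => (h.integral_pi_mul _ j).1.const_mul _,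
    integral_const_mul, (h.integral_pi_mul _ _).2]
  simp [EuclideanSpace.norm_sq_eq, Finset.mul_sum]
  exact Finset.sum_congr rfl fun i _ => by ring

theorem integral_quadForm_sq (h : IsCoordLaw M K κ) (B : ι → ι → ℝ) :
    ∫ r, (∑ i, ∑ j, B i j * (r i * r j)) ^ 2 ∂(Measure.pi fun _ : ι => M) =
      (∫ x, x ^ 2 ∂M) ^ 2 * ((∑ i, B i i) ^ 2 + ∑ i, ∑ j, B i j ^ 2 + ∑ i, ∑ j, B i j * B j i)
      + (∫ x, x ^ 4 ∂M - 3 * (∫ x, x ^ 2 ∂M) ^ 2) * ∑ i, B i i ^ 2 := by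
  classical
  have e : ∀ r : ι → ℝ, (∑ i, ∑ j, B i j * (r i * r j)) ^ 2 =
      ∑ i, ∑ j, ∑ k, ∑ l, B i j * B k l * (r i * r j * r k * r l) := by
    intro r
    rw [sq, Finset.sum_mul]
    refine Finset.sum_congr rfl fun i _ => ?_
    rw [Finset.sum_mul]
    refine Finset.sum_congr rfl fun j _ => ?_
    simp_rw [Finset.mul_sum]
    exact Finset.sum_congr rfl fun k _ => Finset.sum_congr rfl fun l _ => by ring
  simp_rw [e]
  have hi : ∀ i j k l, Integrable (fun r : ι → ℝ => B i j * B k l * (r i * r j * r k * r l))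
      (Measure.pi fun _ => M) := fun i j k l => (h.integral_pi_mul_mul_mul i j k l).1.const_mul _
  rw [integral_finsetSum _ fun i _ => integrable_finsetSum _ fun j _ =>
    integrable_finsetSum _ fun k _ => integrable_finsetSum _ fun l _ => hi i j k l]
  simp_rw [integral_finsetSum Finset.univ fun j _ => integrable_finsetSum _ fun k _ =>
    integrable_finsetSum _ fun l _ => hi _ j k l]
  simp_rw [integral_finsetSum Finset.univ fun k _ => integrable_finsetSum _ fun l _ =>
    hi _ _ k l]
  simp_rw [integral_finsetSum Finset.univ fun l _ => hi _ _ _ l]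
  simp_rw [integral_const_mul, (h.integral_pi_mul_mul_mul _ _ _ _).2]
  generalize (∫ x, x ^ 2 ∂M) ^ 2 = s
  generalize ∫ x, x ^ 4 ∂M - 3 * s = t
  simp only [mul_add, Finset.sum_add_distrib, mul_ite, mul_one, mul_zero, Finset.sum_ite_eq,
    Finset.mem_univ, if_true, Finset.sum_const_zero, Finset.sum_ite_irrel]
  rw [sq (∑ i, B i i), Finset.sum_mul_sum]
  simp only [Finset.sum_mul, sq, mul_comm s, mul_comm t]

end IsCoordLaw

namespace IsCoordLaw

variable {M : Measure ℝ} [IsProbabilityMeasure M] {K κ : ℝ} {ι : Type*} [Fintype ι]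

theorem hasSubgaussianMGF_linForm (h : IsCoordLaw M K κ) {p : EuclideanSpace ℝ ι} (hp : ‖p‖ = 1) :
    HasSubgaussianMGF (linForm p) (9 * K ^ 2).toNNReal (Measure.pi fun _ : ι => M) := by
  have hind : iIndepFun (fun (i : ι) (r : ι → ℝ) => p i * r i) (Measure.pi fun _ : ι => M) :=
    iIndepFun_pi (X := fun i (x : ℝ) => p i * x) (fun i => by fun_prop)
  have hs : ∀ i ∈ (Finset.univ : Finset ι), HasSubgaussianMGF (fun r : ι → ℝ => p i * r i)
      ((p i ^ 2).toNNReal * (9 * K ^ 2).toNNReal) (Measure.pi fun _ : ι => M) := by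
    intro i _
    rw [Real.toNNReal_of_nonneg (sq_nonneg (p i))]
    refine HasSubgaussianMGF.const_mul ?_ (p i)
    have hmp := measurePreserving_eval (fun _ : ι => M) i
    refine HasSubgaussianMGF.of_map (X := fun x : ℝ => x) (Y := fun r : ι → ℝ => r i)
      (measurable_pi_apply i).aemeasurable ?_
    rw [hmp.map_eq]
    exact h.hasSubgaussianMGF
  have := HasSubgaussianMGF.sum_of_iIndepFun hind hs
  rw [← Finset.sum_mul] at this
  have e : ∑ i, (p i ^ 2).toNNReal = 1 := by
    rw [← Real.toNNReal_sum_of_nonneg fun i _ => sq_nonneg _]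
    have := EuclideanSpace.norm_sq_eq p
    rw [hp] at this
    simpa using this.symm
  rw [e, one_mul] at this
  exact this

theorem integrable_exp_linForm_sq (h : IsCoordLaw M K κ) {p : EuclideanSpace ℝ ι} (hp : ‖p‖ = 1) :
    Integrable (fun r => Real.exp (linForm p r ^ 2 / (36 * K ^ 2))) (Measure.pi fun _ : ι => M) ∧
      ∫ r, Real.exp (linForm p r ^ 2 / (36 * K ^ 2)) ∂(Measure.pi fun _ : ι => M)
        ≤ gaussExpSq := by
  have hK := h.K_pos
  have := (h.hasSubgaussianMGF_linForm hp).integrable_exp_sq (Real.toNNReal_pos.2 (by positivity))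
  rw [Real.coe_toNNReal _ (by positivity)] at this
  rwa [show 4 * (9 * K ^ 2) = 36 * K ^ 2 by ring] at this

theorem integrable_linForm_pow (h : IsCoordLaw M K κ) {p : EuclideanSpace ℝ ι} (hp : ‖p‖ = 1)
    (k : ℕ) : Integrable (fun r => linForm p r ^ k) (Measure.pi fun _ : ι => M) := by
  have := h.hasSubgaussianMGF_linForm hp
  exact integrable_pow_of_mem_interior_integrableExpSet
    (by rw [this.integrableExpSet_eq_univ]; simp) k

theorem exp_abs_linForm_sq_sub (h : IsCoordLaw M K κ) {p : EuclideanSpace ℝ ι} (hp : ‖p‖ = 1) :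
    Integrable (fun r => Real.exp (|linForm p r ^ 2 - ∫ x, x ^ 2 ∂M| / (36 * K ^ 2)))
      (Measure.pi fun _ : ι => M) ∧
    ∫ r, Real.exp (|linForm p r ^ 2 - ∫ x, x ^ 2 ∂M| / (36 * K ^ 2)) ∂(Measure.pi fun _ : ι => M)
      ≤ 3 * gaussExpSq := by
  have hK := h.K_pos
  obtain ⟨h1, h2⟩ := h.integrable_exp_linForm_sq hp
  have hv : 0 ≤ ∫ x, x ^ 2 ∂M := integral_nonneg fun x => sq_nonneg x
  have hpt : ∀ r, Real.exp (|linForm p r ^ 2 - ∫ x, x ^ 2 ∂M| / (36 * K ^ 2)) ≤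
      3 * Real.exp (linForm p r ^ 2 / (36 * K ^ 2)) := by
    intro r
    have h3 : |linForm p r ^ 2 - ∫ x, x ^ 2 ∂M| / (36 * K ^ 2) ≤
        1 + linForm p r ^ 2 / (36 * K ^ 2) := by
      rw [div_le_iff₀ (by positivity), add_mul, div_mul_cancel₀ _ (by positivity)]
      rw [abs_le]
      constructor <;> nlinarith [h.integral_sq_le, sq_nonneg (linForm p r), sq_nonneg K]
    refine (Real.exp_le_exp.2 h3).trans ?_
    rw [Real.exp_add]
    gcongr
    linarith [Real.exp_one_lt_d9]
  have hi := integrable_of_exp_bound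
    (f := fun r => Real.exp (|linForm p r ^ 2 - ∫ x, x ^ 2 ∂M| / (36 * K ^ 2)))
    (by fun_prop) 3 h1 (fun r => by
      rw [abs_of_pos (Real.exp_pos _)]
      exact hpt r)
  refine ⟨hi, ?_⟩
  have := integral_mono hi (h1.const_mul 3) hpt
  rw [integral_const_mul] at this
  linarith

theorem integral_linForm_pow_eight_le (h : IsCoordLaw M K κ) {p : EuclideanSpace ℝ ι}
    (hp : ‖p‖ = 1) :
    ∫ r, linForm p r ^ 8 ∂(Measure.pi fun _ : ι => M) ≤ 24 * (36 * K ^ 2) ^ 4 * gaussExpSq := by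
  have hK := h.K_pos
  obtain ⟨h1, h2⟩ := h.integrable_exp_linForm_sq hp
  have := integral_mono (h.integrable_linForm_pow hp 8) (h1.const_mul (24 * (36 * K ^ 2) ^ 4))
    (fun r => by
      have h1 := Real.pow_div_factorial_le_exp (linForm p r ^ 2 / (36 * K ^ 2)) (by positivity) 4
      have e : linForm p r ^ 8 = 24 * (36 * K ^ 2) ^ 4 *
          ((linForm p r ^ 2 / (36 * K ^ 2)) ^ 4 / (Nat.factorial 4 : ℝ)) := by
        simp [Nat.factorial]; field_simp
      simp only
      rw [e]
      gcongr)
  rw [integral_const_mul] at this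
  refine this.trans ?_
  gcongr

/-- The second moment of the quadratic form `(pᵀr)(sᵀr) + (p'ᵀr)(s'ᵀr)`. Since the fourth moment
exceeds the squared variance by `κ`, the diagonal part of the form contributes as much as the
off-diagonal part. -/
theorem le_integral_linForm_mul_add_sq (h : IsCoordLaw M K κ) {p s p' s' : EuclideanSpace ℝ ι}
    (hp : ‖p‖ = 1) (hs : ‖s‖ = 1) (hp' : ‖p'‖ = 1) (hs' : ‖s'‖ = 1)
    (hpp : inner ℝ p p' = 0) (hps : inner ℝ p s' = 0) :
    min (2 * (κ ^ 2 / (48 * K ^ 6)) ^ 2) κ ≤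
      ∫ r, (linForm p r * linForm s r + linForm p' r * linForm s' r) ^ 2
        ∂(Measure.pi fun _ : ι => M) := by
  have hK := h.K_pos
  have hκ := h.κ_pos
  set B : ι → ι → ℝ := fun i j => p i * s j + p' i * s' j with hB
  have e : ∀ r : ι → ℝ, linForm p r * linForm s r + linForm p' r * linForm s' r =
      ∑ i, ∑ j, B i j * (r i * r j) := by
    intro r
    simp only [linForm, Finset.sum_mul_sum, ← Finset.sum_add_distrib, hB]
    exact Finset.sum_congr rfl fun i _ => Finset.sum_congr rfl fun j _ => by ring
  simp_rw [e, h.integral_quadForm_sq B]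
  set v := ∫ x, x ^ 2 ∂M
  set m4 := ∫ x, x ^ 4 ∂M
  have hin : ∀ a b : EuclideanSpace ℝ ι, ∑ i, a i * b i = inner ℝ a b := fun a b => by
    simp [PiLp.inner_apply, mul_comm]
  have hsum : ∀ a b c e : EuclideanSpace ℝ ι, ∑ i, ∑ j, (a i * b i) * (c j * e j) =
      inner ℝ a b * inner ℝ c e := fun a b c e => by
    rw [← hin, ← hin, Finset.sum_mul_sum]
  -- the Hilbert-Schmidt norm of the symmetrisation of `B`
  have hF : ∑ i, ∑ j, B i j ^ 2 + ∑ i, ∑ j, B i j * B j i =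
      2 + inner ℝ p s ^ 2 + inner ℝ p' s' ^ 2 := by
    have e1 : ∑ i, ∑ j, B i j ^ 2 + ∑ i, ∑ j, B i j * B j i =
        (∑ i, ∑ j, (p i * p i) * (s j * s j) + ∑ i, ∑ j, (p' i * p' i) * (s' j * s' j)
        + 2 * ∑ i, ∑ j, (p i * p' i) * (s j * s' j))
        + (∑ i, ∑ j, (p i * s i) * (p j * s j) + ∑ i, ∑ j, (p' i * s' i) * (p' j * s' j)
        + 2 * ∑ i, ∑ j, (p i * s' i) * (p' j * s j)) := by
      have sw : ∑ i, ∑ j, (p i * s' i) * (p' j * s j) = ∑ i, ∑ j, (p j * s' j) * (p' i * s i) :=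
        Finset.sum_comm
      rw [two_mul (∑ i, ∑ j, (p i * s' i) * (p' j * s j))]
      nth_rewrite 2 [sw]
      simp only [Finset.mul_sum, ← Finset.sum_add_distrib]
      exact Finset.sum_congr rfl fun i _ => Finset.sum_congr rfl fun j _ => by
        simp only [hB]; ring
    rw [e1]
    simp only [hsum, real_inner_self_eq_norm_sq, hp, hs, hp', hs', hpp, hps]
    ring
  have hdiag : 2 * ∑ i, B i i ^ 2 ≤ ∑ i, ∑ j, B i j ^ 2 + ∑ i, ∑ j, B i j * B j i := by
    have e2 : ∑ i, ∑ j, B i j ^ 2 + ∑ i, ∑ j, B i j * B j i =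
        ∑ i, ∑ j, (B i j + B j i) ^ 2 / 2 := by
      have sw : ∑ i, ∑ j, B i j ^ 2 = ∑ i, ∑ j, B j i ^ 2 := Finset.sum_comm
      have : ∑ i, ∑ j, B i j ^ 2 = ∑ i, ∑ j, (B i j ^ 2 / 2 + B j i ^ 2 / 2) := by
        simp only [Finset.sum_add_distrib, ← Finset.sum_div]
        rw [← sw]; ring
      rw [this]
      simp only [← Finset.sum_add_distrib]
      exact Finset.sum_congr rfl fun i _ => Finset.sum_congr rfl fun j _ => by ring
    rw [e2, Finset.mul_sum]
    refine Finset.sum_le_sum fun i _ => ?_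
    calc 2 * B i i ^ 2 = (B i i + B i i) ^ 2 / 2 := by ring
      _ ≤ _ := Finset.single_le_sum (f := fun j => (B i j + B j i) ^ 2 / 2)
        (fun j _ => by positivity) (Finset.mem_univ i)
  set F := ∑ i, ∑ j, B i j ^ 2 + ∑ i, ∑ j, B i j * B j i
  set G := ∑ i, B i i ^ 2
  have hG : 0 ≤ G := Finset.sum_nonneg fun i _ => sq_nonneg _
  have hF2 : 2 ≤ F := by rw [hF]; nlinarith [sq_nonneg (inner ℝ p s), sq_nonneg (inner ℝ p' s')]
  have hv2 : (κ ^ 2 / (48 * K ^ 6)) ^ 2 ≤ v ^ 2 := by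
    have := h.le_integral_sq
    gcongr
  have hm := h.kurtosis
  set lo := min (2 * (κ ^ 2 / (48 * K ^ 6)) ^ 2) κ
  have hl1 : lo ≤ 2 * v ^ 2 := (min_le_left _ _).trans (by linarith)
  have hl2 : lo ≤ κ := min_le_right _ _
  have hl0 : 0 ≤ lo := le_min (by positivity) hκ.le
  have h1 : 0 ≤ v ^ 2 * (∑ i, B i i) ^ 2 := by positivity
  have h2 : lo / 2 * (F - 2 * G) ≤ v ^ 2 * (F - 2 * G) :=
    mul_le_mul_of_nonneg_right (by linarith) (by linarith)
  have h3 : lo * G ≤ (m4 - v ^ 2) * G := mul_le_mul_of_nonneg_right (by linarith) hG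
  nlinarith [mul_le_mul_of_nonneg_left hF2 hl0]

end IsCoordLaw

/-- A lower bound for the mean modulus of `(pᵀr)(sᵀr) + (p'ᵀr)(s'ᵀr)`, from its second and fourth
moments. -/
theorem exists_le_integral_abs_linForm_mul_add {K κ : ℝ} (hK : 0 < K) (hκ : 0 < κ) :
    ∃ c C : ℝ, 0 < c ∧ 0 < C ∧ ∀ (M : Measure ℝ) [IsProbabilityMeasure M], IsCoordLaw M K κ →
      ∀ (ι : Type) [Fintype ι] (p s p' s' : EuclideanSpace ℝ ι), ‖p‖ = 1 → ‖s‖ = 1 → ‖p'‖ = 1 →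
        ‖s'‖ = 1 → inner ℝ p p' = 0 → inner ℝ p s' = 0 →
        Integrable (fun r => |linForm p r * linForm s r + linForm p' r * linForm s' r|)
          (Measure.pi fun _ : ι => M) ∧
        Integrable (fun r => |linForm p r * linForm s r + linForm p' r * linForm s' r| ^ 2)
          (Measure.pi fun _ : ι => M) ∧
        c ≤ ∫ r, |linForm p r * linForm s r + linForm p' r * linForm s' r|
          ∂(Measure.pi fun _ : ι => M) ∧
        ∫ r, |linForm p r * linForm s r + linForm p' r * linForm s' r| ^ 2
          ∂(Measure.pi fun _ : ι => M) ≤ C := by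
  set c0 := min (2 * (κ ^ 2 / (48 * K ^ 6)) ^ 2) κ with hc0
  have hc0p : 0 < c0 := lt_min (by positivity) hκ
  set C4 := 16 * (24 * (36 * K ^ 2) ^ 4 * gaussExpSq) with hC4
  have hg := one_le_gaussExpSq
  have hC4p : 0 < C4 := by positivity
  -- the `T` in `|Q| ≥ Q² / T - Q⁴ / T³`, chosen so that the mean of the right-hand side is at least
  -- `c0 / T - C4 / T³ = c0 / (2T)`
  set T := √(2 * C4 / c0) with hT
  have hTp : 0 < T := Real.sqrt_pos.2 (by positivity)
  have hT2 : T ^ 2 = 2 * C4 / c0 := Real.sq_sqrt (by positivity)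
  refine ⟨c0 / (2 * T), 1 + C4, by positivity, by positivity, ?_⟩
  intro M _ h ι _ p s p' s' hp hs hp' hs' hpp hps
  set ν := Measure.pi fun _ : ι => M
  set Q : (ι → ℝ) → ℝ := fun r => linForm p r * linForm s r + linForm p' r * linForm s' r with hQ
  have hQm : Measurable Q := by fun_prop
  have h8 : Integrable (fun r => 4 * (linForm p r ^ 8 + linForm s r ^ 8 + linForm p' r ^ 8
      + linForm s' r ^ 8)) ν :=
    ((((h.integrable_linForm_pow hp 8).add (h.integrable_linForm_pow hs 8)).add
      (h.integrable_linForm_pow hp' 8)).add (h.integrable_linForm_pow hs' 8)).const_mul 4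
  have hQ4 : ∀ r, Q r ^ 4 ≤ 4 * (linForm p r ^ 8 + linForm s r ^ 8 + linForm p' r ^ 8
      + linForm s' r ^ 8) := by
    intro r
    have four : ∀ x y : ℝ, (x + y) ^ 4 ≤ 8 * (x ^ 4 + y ^ 4) := fun x y => by
      have h1 : (x + y) ^ 2 ≤ 2 * (x ^ 2 + y ^ 2) := by nlinarith [sq_nonneg (x - y)]
      have h2 : 0 ≤ (x + y) ^ 2 := sq_nonneg _
      calc (x + y) ^ 4 = ((x + y) ^ 2) ^ 2 := by ring
        _ ≤ (2 * (x ^ 2 + y ^ 2)) ^ 2 := by gcongr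
        _ ≤ _ := by nlinarith [sq_nonneg (x ^ 2 - y ^ 2)]
    have := four (linForm p r * linForm s r) (linForm p' r * linForm s' r)
    rw [mul_pow, mul_pow] at this
    nlinarith [sq_nonneg (linForm p r ^ 4 - linForm s r ^ 4),
      sq_nonneg (linForm p' r ^ 4 - linForm s' r ^ 4)]
  have i4 : Integrable (fun r => Q r ^ 4) ν := by
    refine integrable_of_exp_bound (by fun_prop) 1 h8 fun r => ?_
    rw [abs_of_nonneg (by positivity), one_mul]
    exact hQ4 r
  have v4 : ∫ r, Q r ^ 4 ∂ν ≤ C4 := by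
    refine (integral_mono i4 h8 hQ4).trans ?_
    have ip := h.integrable_linForm_pow hp 8
    have is := h.integrable_linForm_pow hs 8
    have ip' := h.integrable_linForm_pow hp' 8
    have is' := h.integrable_linForm_pow hs' 8
    rw [integral_const_mul, 
      integral_add (f := fun r => linForm p r ^ 8 + linForm s r ^ 8 + linForm p' r ^ 8)
        ((ip.add is).add ip') is',
      integral_add (f := fun r => linForm p r ^ 8 + linForm s r ^ 8) (ip.add is) ip',
      integral_add ip is]
    linarith [h.integral_linForm_pow_eight_le hp, h.integral_linForm_pow_eight_le hs,
      h.integral_linForm_pow_eight_le hp', h.integral_linForm_pow_eight_le hs']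
  have i4' : Integrable (fun r => 1 + Q r ^ 4) ν := (integrable_const 1).add i4
  have i2 : Integrable (fun r => Q r ^ 2) ν := by
    refine integrable_of_exp_bound (by fun_prop) 1 i4' fun r => ?_
    rw [abs_of_nonneg (by positivity), one_mul]
    nlinarith [sq_nonneg (Q r ^ 2 - 1)]
  have i1 : Integrable (fun r => |Q r|) ν := by
    refine integrable_of_exp_bound (by fun_prop) 1 ((integrable_const 1).add i2) fun r => ?_
    simp only [Pi.add_apply]
    rw [abs_abs, one_mul, ← sq_abs]
    nlinarith [sq_nonneg (|Q r| - 1)]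
  simp_rw [sq_abs]
  refine ⟨i1, i2, ?_, ?_⟩
  · have hpt : ∀ r, 1 / T * Q r ^ 2 - 1 / T ^ 3 * Q r ^ 4 ≤ |Q r| := by
      intro r
      rw [← sq_abs, show Q r ^ 4 = |Q r| ^ 4 by rw [pow_abs, abs_of_nonneg (by positivity)]]
      set q := |Q r|
      have hq : 0 ≤ q := abs_nonneg _
      set y := q / T with hy
      have hy0 : 0 ≤ y := by positivity
      have e : 1 / T * q ^ 2 - 1 / T ^ 3 * q ^ 4 = q * (y - y ^ 3) := by
        rw [hy]; field_simp
      rw [e]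
      have : y - y ^ 3 ≤ 1 := by
        nlinarith [mul_nonneg hy0 (sq_nonneg (y - 1)), sq_nonneg (y - 1), sq_nonneg y]
      nlinarith
    have := integral_mono ((i2.const_mul (1 / T)).sub (i4.const_mul (1 / T ^ 3))) i1 hpt
    rw [integral_sub' (i2.const_mul _) (i4.const_mul _), integral_const_mul,
      integral_const_mul] at this
    refine le_trans ?_ this
    have hlow := h.le_integral_linForm_mul_add_sq hp hs hp' hs' hpp hps
    calc c0 / (2 * T) = 1 / T * c0 - 1 / T ^ 3 * C4 := by
          rw [show 1 / T ^ 3 * C4 = C4 / (T * T ^ 2) by ring, hT2]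
          field_simp
          ring
      _ ≤ _ := by
        gcongr
  · have := integral_mono i2 i4' (fun r => by
      simp only
      nlinarith [sq_nonneg (Q r ^ 2 - 1)])
    rw [integral_add (integrable_const 1) i4] at this
    simp at this
    linarith

/-! ### From nets to all directions -/

/-- A symmetric bilinear form bounded by `t` on the diagonal over a `1/4`-net of the unit sphere is
bounded by `2t`: if `S` is the maximum of `|β x x|` over the sphere, attained at `x`, and `y` is a
net point close to `x`, then `β x x - β y y = β (x - y) (x + y)` is at most `S / 2`. -/
theorem abs_bilin_le_of_net {E : Type*} [NormedAddCommGroup E] [InnerProductSpace ℝ E]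
    [FiniteDimensional ℝ E] (β : E →ₗ[ℝ] E →ₗ[ℝ] ℝ) (hsymm : ∀ x y, β x y = β y x)
    (hcont : Continuous fun x => β x x) (N : Finset E) (hN1 : ∀ y ∈ N, ‖y‖ = 1)
    (hN : ∀ x : E, ‖x‖ = 1 → ∃ y ∈ N, ‖x - y‖ ≤ 1 / 4) {t : ℝ} (ht : ∀ y ∈ N, |β y y| ≤ t)
    (x y : E) : |β x y| ≤ 2 * t * ‖x‖ * ‖y‖ := by
  rcases eq_or_ne x 0 with rfl | hx
  · simp
  rcases eq_or_ne y 0 with rfl | hy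
  · simp
  have hunit : ∀ z : E, z ≠ 0 → ‖(‖z‖⁻¹ • z)‖ = 1 := fun z hz => by
    rw [norm_smul, norm_inv, norm_norm, inv_mul_cancel₀ (norm_ne_zero_iff.2 hz)]
  obtain ⟨x₀, hx₀, hmax⟩ := (isCompact_sphere (0 : E) 1).exists_isMaxOn
    ⟨‖x‖⁻¹ • x, by simpa using hunit x hx⟩ hcont.abs.continuousOn
  have hx₀1 : ‖x₀‖ = 1 := by simpa using hx₀
  set S := |β x₀ x₀| with hS
  have hS0 : 0 ≤ S := abs_nonneg _
  have hdiag : ∀ z, |β z z| ≤ S * ‖z‖ ^ 2 := by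
    intro z
    rcases eq_or_ne z 0 with rfl | hz
    · simp
    have h1 : |β (‖z‖⁻¹ • z) (‖z‖⁻¹ • z)| ≤ S := by
      have := hmax (show ‖z‖⁻¹ • z ∈ Metric.sphere (0 : E) 1 by simpa using hunit z hz)
      simpa using this
    have hz' : 0 < ‖z‖ := norm_pos_iff.2 hz
    have e : β z z = ‖z‖ ^ 2 * β (‖z‖⁻¹ • z) (‖z‖⁻¹ • z) := by
      simp only [map_smul, LinearMap.smul_apply, smul_eq_mul]
      field_simp
    rw [e, abs_mul, abs_of_pos (by positivity), mul_comm]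
    gcongr
  have hunitbound : ∀ a b : E, ‖a‖ = 1 → ‖b‖ = 1 → |β a b| ≤ S := by
    intro a b ha hb
    have e : β a b = (β (a + b) (a + b) - β (a - b) (a - b)) / 4 := by
      simp only [map_add, map_sub, LinearMap.add_apply, LinearMap.sub_apply]
      rw [hsymm b a]
      ring
    have hp := parallelogram_law_with_norm ℝ a b
    rw [ha, hb] at hp
    rw [e, abs_div, abs_of_pos (by norm_num : (0 : ℝ) < 4), div_le_iff₀ (by norm_num)]
    calc |β (a + b) (a + b) - β (a - b) (a - b)|
        ≤ |β (a + b) (a + b)| + |β (a - b) (a - b)| := abs_sub _ _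
      _ ≤ S * ‖a + b‖ ^ 2 + S * ‖a - b‖ ^ 2 := add_le_add (hdiag _) (hdiag _)
      _ = S * 4 := by linear_combination S * hp
  have hall : ∀ a b : E, |β a b| ≤ S * ‖a‖ * ‖b‖ := by
    intro a b
    rcases eq_or_ne a 0 with rfl | ha
    · simp
    rcases eq_or_ne b 0 with rfl | hb
    · simp
    have h1 := hunitbound _ _ (hunit a ha) (hunit b hb)
    have ha' : 0 < ‖a‖ := norm_pos_iff.2 ha
    have hb' : 0 < ‖b‖ := norm_pos_iff.2 hb
    have e : β a b = (‖a‖ * ‖b‖) * β (‖a‖⁻¹ • a) (‖b‖⁻¹ • b) := by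
      simp only [map_smul, LinearMap.smul_apply, smul_eq_mul]
      field_simp
    rw [e, abs_mul, abs_of_pos (by positivity)]
    nlinarith [mul_le_mul_of_nonneg_left h1 (mul_pos ha' hb').le]
  obtain ⟨z, hz, hxz⟩ := hN x₀ hx₀1
  have hS2 : S ≤ 2 * t := by
    have e : β x₀ x₀ = β z z + β (x₀ - z) (x₀ + z) := by
      simp only [map_add, map_sub, LinearMap.sub_apply]
      rw [hsymm x₀ z]
      ring
    have h1 : |β (x₀ - z) (x₀ + z)| ≤ S * (1 / 4) * 2 := by
      refine (hall _ _).trans ?_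
      have : ‖x₀ + z‖ ≤ 2 := (norm_add_le _ _).trans (by rw [hx₀1, hN1 z hz]; norm_num)
      gcongr
    have h2 : S ≤ |β z z| + |β (x₀ - z) (x₀ + z)| := by
      rw [hS, e]
      exact abs_add_le _ _
    linarith [ht z hz]
  refine (hall x y).trans ?_
  gcongr

section

variable {ι : Type*} [Fintype ι] {n : ℕ}

/-- The bilinear form of the centred weighted covariance `∑ₖ gₖ (rₖ rₖᵀ - v I)`. -/
noncomputable def covForm (g : Fin n → ℝ) (v : ℝ) (r : Fin n → ι → ℝ) :
    EuclideanSpace ℝ ι →ₗ[ℝ] EuclideanSpace ℝ ι →ₗ[ℝ] ℝ :=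
  LinearMap.mk₂ ℝ
    (fun p q => ∑ k, g k * (linForm p (r k) * linForm q (r k) - v * inner ℝ p q))
    (fun p p' q => by
      simp only [linForm_add, inner_add_left, ← Finset.sum_add_distrib]
      exact Finset.sum_congr rfl fun k _ => by ring)
    (fun a p q => by
      simp only [linForm_smul, real_inner_smul_left, smul_eq_mul, Finset.mul_sum]
      exact Finset.sum_congr rfl fun k _ => by ring)
    (fun p q q' => by
      simp only [linForm_add, inner_add_right, ← Finset.sum_add_distrib]
      exact Finset.sum_congr rfl fun k _ => by ring)
    (fun a p q => by
      simp only [linForm_smul, real_inner_smul_right, smul_eq_mul, Finset.mul_sum]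
      exact Finset.sum_congr rfl fun k _ => by ring)

theorem covForm_apply (g : Fin n → ℝ) (v : ℝ) (r : Fin n → ι → ℝ) (p q : EuclideanSpace ℝ ι) :
    covForm g v r p q = ∑ k, g k * (linForm p (r k) * linForm q (r k) - v * inner ℝ p q) := rfl

theorem covForm_self (g : Fin n → ℝ) (v : ℝ) (r : Fin n → ι → ℝ) {p : EuclideanSpace ℝ ι}
    (hp : ‖p‖ = 1) : covForm g v r p p = ∑ k, g k * (linForm p (r k) ^ 2 - v) := by
  rw [covForm_apply, real_inner_self_eq_norm_sq, hp]
  exact Finset.sum_congr rfl fun k _ => by ring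

theorem abs_covForm_le_of_net (g : Fin n → ℝ) (v : ℝ) (r : Fin n → ι → ℝ)
    (N : Finset (EuclideanSpace ℝ ι)) (hN1 : ∀ y ∈ N, ‖y‖ = 1)
    (hN : ∀ x : EuclideanSpace ℝ ι, ‖x‖ = 1 → ∃ y ∈ N, ‖x - y‖ ≤ 1 / 4) {t : ℝ}
    (ht : ∀ p ∈ N, |∑ k, g k * (linForm p (r k) ^ 2 - v)| ≤ t) (p q : EuclideanSpace ℝ ι) :
    |covForm g v r p q| ≤ 2 * t * ‖p‖ * ‖q‖ := by
  refine abs_bilin_le_of_net (covForm g v r) (fun x y => ?_) ?_ N hN1 hN (fun p hp => ?_) p q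
  · simp only [covForm_apply]
    exact Finset.sum_congr rfl fun k _ => by rw [mul_comm (linForm x _), real_inner_comm]
  · simp only [covForm_apply]
    fun_prop
  · rw [covForm_self g v r (hN1 p hp)]
    exact ht p hp

theorem sum_abs_mul_le_of_sq_le {a b : Fin n → ℝ} {x y : ℝ} (hx : 0 ≤ x) (hy : 0 ≤ y)
    (ha : ∑ k, a k ^ 2 ≤ x ^ 2) (hb : ∑ k, b k ^ 2 ≤ y ^ 2) : ∑ k, |a k * b k| ≤ x * y := by
  have h := Finset.sum_mul_sq_le_sq_mul_sq Finset.univ (fun k => |a k|) (fun k => |b k|)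
  simp only [sq_abs, ← abs_mul] at h
  refine abs_le_of_sq_le_sq' ?_ (by positivity) |>.2
  rw [mul_pow]
  refine h.trans ?_
  have : 0 ≤ ∑ k, b k ^ 2 := Finset.sum_nonneg fun k _ => sq_nonneg _
  gcongr

/-- The lower bound for `∑ₖ |Q(rₖ)|` extends from a net of pairs to nearby pairs. -/
theorem sum_abs_linForm_mul_add_ge {r : Fin n → ι → ℝ} {D : ℝ} (hD : 0 ≤ D)
    (hr : ∀ p : EuclideanSpace ℝ ι, ∑ k, linForm p (r k) ^ 2 ≤ D * ‖p‖ ^ 2)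
    {p s p' s' q t q' t' : EuclideanSpace ℝ ι} {δ : ℝ} (hδ : 0 ≤ δ)
    (hs : ‖s‖ = 1) (hs' : ‖s'‖ = 1) (hq : ‖q‖ = 1) (hq' : ‖q'‖ = 1)
    (hpq : ‖p - q‖ ≤ δ) (hst : ‖s - t‖ ≤ δ) (hpq' : ‖p' - q'‖ ≤ δ) (hst' : ‖s' - t'‖ ≤ δ) :
    ∑ k, |linForm q (r k) * linForm t (r k) + linForm q' (r k) * linForm t' (r k)| - 4 * (D * δ)
      ≤ ∑ k, |linForm p (r k) * linForm s (r k) + linForm p' (r k) * linForm s' (r k)| := by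
  have hb : ∀ a b : EuclideanSpace ℝ ι, ‖a‖ ≤ δ → ‖b‖ = 1 →
      ∑ k, |linForm a (r k) * linForm b (r k)| ≤ D * δ := by
    intro a b ha hb
    have h := sum_abs_mul_le_of_sq_le (a := fun k => linForm a (r k))
      (b := fun k => linForm b (r k)) (x := √D * δ) (y := √D) (by positivity) (by positivity)
      (by
        rw [mul_pow, Real.sq_sqrt hD]
        refine (hr a).trans ?_
        gcongr)
      (by
        rw [Real.sq_sqrt hD]
        have := hr b
        rwa [hb, one_pow, mul_one] at this)
    refine h.trans_eq ?_
    rw [mul_right_comm, Real.mul_self_sqrt hD]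
  have hpt : ∀ k, |linForm q (r k) * linForm t (r k) + linForm q' (r k) * linForm t' (r k)| ≤
      |linForm p (r k) * linForm s (r k) + linForm p' (r k) * linForm s' (r k)|
      + (|linForm (p - q) (r k) * linForm s (r k)| + |linForm (s - t) (r k) * linForm q (r k)|
      + |linForm (p' - q') (r k) * linForm s' (r k)|
      + |linForm (s' - t') (r k) * linForm q' (r k)|) := by
    intro k
    have e : linForm q (r k) * linForm t (r k) + linForm q' (r k) * linForm t' (r k) =
      (linForm p (r k) * linForm s (r k) + linForm p' (r k) * linForm s' (r k))
      - (linForm (p - q) (r k) * linForm s (r k) + linForm (s - t) (r k) * linForm q (r k)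
      + linForm (p' - q') (r k) * linForm s' (r k)
      + linForm (s' - t') (r k) * linForm q' (r k)) := by
      simp only [linForm_sub]
      ring
    rw [e]
    refine (abs_sub _ _).trans ?_
    gcongr
    refine (abs_add_le _ _).trans ?_
    gcongr
    refine (abs_add_le _ _).trans ?_
    gcongr
    exact abs_add_le _ _
  have hsum := Finset.sum_le_sum fun k (_ : k ∈ Finset.univ) => hpt k
  simp only [Finset.sum_add_distrib] at hsum
  have h1 := hb _ _ hpq hs
  have h2 := hb _ _ hst hq
  have h3 := hb _ _ hpq' hs'
  have h4 := hb _ _ hst' hq'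
  linarith

end

/-! ### High-probability events for the measurement vectors -/

namespace IsCoordLaw

variable {M : Measure ℝ} [IsProbabilityMeasure M] {K κ : ℝ} {ι : Type} [Fintype ι] {n : ℕ}

theorem measureReal_abs_sum_linForm_sq_gt_le (h : IsCoordLaw M K κ) (hn : 0 < n)
    {p : EuclideanSpace ℝ ι} (hp : ‖p‖ = 1) {g : Fin n → ℝ} {R : ℝ} (hR : 0 < R)
    (hg : ∀ k, |g k| ≤ R) {m : ℝ} (hm0 : 0 ≤ m) (hmn : m ≤ n) :
    (Measure.pi fun _ : Fin n => Measure.pi fun _ : ι => M).real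
      {r | 72 * K ^ 2 * (6 * gaussExpSq + 4) * R * √(n * m) <
        |∑ k, g k * (linForm p (r k) ^ 2 - ∫ x, x ^ 2 ∂M)|} ≤ 2 * Real.exp (-4 * m) := by
  have hK := h.K_pos
  set ν := Measure.pi fun _ : ι => M with hν
  set v := ∫ x, x ^ 2 ∂M with hv
  have hind : iIndepFun (fun (k : Fin n) (r : Fin n → ι → ℝ) => linForm p (r k) ^ 2 - v)
      (Measure.pi fun _ : Fin n => ν) :=
    iIndepFun_pi (X := fun _ (x : ι → ℝ) => linForm p x ^ 2 - v) (fun k => by fun_prop)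
  obtain ⟨i1, i2⟩ := h.exp_abs_linForm_sq_sub hp
  have hb : 0 < 36 * K ^ 2 := by positivity
  have := measureReal_abs_weighted_sum_gt_le hn hind (fun k => by fun_prop) hb
    (B := 3 * gaussExpSq)
    (fun k => (measurePreserving_eval (fun _ : Fin n => ν) k).integrable_comp_of_integrable i1)
    (fun k => by
      rw [integral_comp_eval (μ := fun _ : Fin n => ν) (i := k)
        (f := fun x => Real.exp (|linForm p x ^ 2 - v| / (36 * K ^ 2))) i1.aestronglyMeasurable]
      exact i2)
    (fun k => by
      have hi := (h.integrable_linForm_pow hp 2)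
      rw [integral_comp_eval (μ := fun _ : Fin n => ν) (i := k)
        (f := fun x => linForm p x ^ 2 - v) (by fun_prop),
        integral_sub hi (integrable_const v), h.integral_linForm_sq, hp]
      simp [hv])
    hR hg hm0 hmn (72 * K ^ 2 * (6 * gaussExpSq + 4))
  refine this.trans_eq ?_
  congr 3
  field_simp
  ring

/-- Union bound over a net of at most `9 ^ dim ≤ exp (3 dim)` unit vectors; the constant in the
deviation is the one for which a single direction fails with probability `2 exp (-4 dim)`. -/
theorem measureReal_exists_abs_sum_linForm_sq_gt_le (h : IsCoordLaw M K κ) (hn : 0 < n)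
    (hmn : (Fintype.card ι : ℝ) ≤ n) (N : Finset (EuclideanSpace ℝ ι)) (hN1 : ∀ p ∈ N, ‖p‖ = 1)
    (hcard : (N.card : ℝ) ≤ 9 ^ Fintype.card ι) {g : Fin n → ℝ} {R : ℝ} (hR : 0 < R)
    (hg : ∀ k, |g k| ≤ R) :
    (Measure.pi fun _ : Fin n => Measure.pi fun _ : ι => M).real
      {r | ∃ p ∈ N, 72 * K ^ 2 * (6 * gaussExpSq + 4) * R * √(n * Fintype.card ι) <
        |∑ k, g k * (linForm p (r k) ^ 2 - ∫ x, x ^ 2 ∂M)|}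
      ≤ 2 * Real.exp (-Fintype.card ι) := by
  set m := Fintype.card ι
  have e : {r : Fin n → ι → ℝ | ∃ p ∈ N, 72 * K ^ 2 * (6 * gaussExpSq + 4) * R * √(n * m) <
        |∑ k, g k * (linForm p (r k) ^ 2 - ∫ x, x ^ 2 ∂M)|} =
      ⋃ p ∈ N, {r | 72 * K ^ 2 * (6 * gaussExpSq + 4) * R * √(n * m) <
        |∑ k, g k * (linForm p (r k) ^ 2 - ∫ x, x ^ 2 ∂M)|} := by
    ext r
    simp
  rw [e]
  refine (measureReal_biUnion_finset_le _ _).trans ?_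
  refine (Finset.sum_le_sum fun p hp => h.measureReal_abs_sum_linForm_sq_gt_le hn (hN1 p hp) hR hg
    (Nat.cast_nonneg m) hmn).trans ?_
  rw [Finset.sum_const, nsmul_eq_mul]
  have h9 : (9 : ℝ) ^ m ≤ Real.exp (3 * m) := by
    rw [mul_comm, Real.exp_nat_mul]
    gcongr
    calc (9 : ℝ) ≤ 2.7 ^ 3 := by norm_num
      _ ≤ Real.exp 1 ^ 3 := by gcongr; linarith [Real.exp_one_gt_d9]
      _ = Real.exp 3 := by rw [← Real.exp_nat_mul]; norm_num
  calc (N.card : ℝ) * (2 * Real.exp (-4 * m)) ≤ Real.exp (3 * m) * (2 * Real.exp (-4 * m)) := by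
        gcongr
        exact hcard.trans h9
    _ = 2 * (Real.exp (3 * m) * Real.exp (-4 * m)) := by ring
    _ = 2 * Real.exp (-m) := by rw [← Real.exp_add]; congr 2; ring

end IsCoordLaw

theorem measureReal_prod_le {α β : Type*} [MeasurableSpace α] [MeasurableSpace β]
    {ρ : Measure α} {ν : Measure β} [IsProbabilityMeasure ρ] [IsProbabilityMeasure ν]
    {B : Set (α × β)} (hB : MeasurableSet B) {ε : ℝ} (hε : 0 ≤ ε)
    (h : ∀ a, ν.real (Prod.mk a ⁻¹' B) ≤ ε) : (ρ.prod ν).real B ≤ ε := by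
  rw [measureReal_def, Measure.prod_apply hB]
  refine ENNReal.toReal_le_of_le_ofReal hε ?_
  calc ∫⁻ a, ν (Prod.mk a ⁻¹' B) ∂ρ ≤ ∫⁻ _a, ENNReal.ofReal ε ∂ρ := by
        refine lintegral_mono fun a => ?_
        rw [← ofReal_measureReal]
        exact ENNReal.ofReal_le_ofReal (h a)
    _ = ENNReal.ofReal ε := by simp

/-- The real form of multiplication by `-i` on `ℂᵈ`, in the coordinates
`(Re x, Im x) ∈ ℝᵈ × ℝᵈ`. -/
noncomputable def rot {d : ℕ} (p : EuclideanSpace ℝ (Fin d ⊕ Fin d)) :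
    EuclideanSpace ℝ (Fin d ⊕ Fin d) :=
  WithLp.toLp 2 (Sum.elim (fun i => p (Sum.inr i)) (fun i => -p (Sum.inl i)))

section

variable {d : ℕ}

theorem inner_rot_rot (p q : EuclideanSpace ℝ (Fin d ⊕ Fin d)) :
    inner ℝ (rot p) (rot q) = inner ℝ p q := by
  simp [PiLp.inner_apply, rot, add_comm]

theorem norm_rot (p : EuclideanSpace ℝ (Fin d ⊕ Fin d)) : ‖rot p‖ = ‖p‖ := by
  rw [← sq_eq_sq₀ (norm_nonneg _) (norm_nonneg _), ← real_inner_self_eq_norm_sq,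
    ← real_inner_self_eq_norm_sq, inner_rot_rot]

theorem rot_sub (p q : EuclideanSpace ℝ (Fin d ⊕ Fin d)) : rot (p - q) = rot p - rot q := by
  ext i
  rcases i with i | i <;> simp [rot]
  ring

theorem rot_smul (a : ℝ) (p : EuclideanSpace ℝ (Fin d ⊕ Fin d)) : rot (a • p) = a • rot p := by
  ext i
  rcases i with i | i <;> simp [rot]

theorem inner_self_rot (p : EuclideanSpace ℝ (Fin d ⊕ Fin d)) : inner ℝ p (rot p) = 0 := by
  simp [PiLp.inner_apply, rot, mul_comm]

end

/-- The event on which both the lower bound for the quadratic forms of the measurement vectors and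
the upper bound for the noise form hold, uniformly in the directions. The noise is integrated
last, the measurement vectors being independent of it. -/
theorem exists_good_event {K κ : ℝ} (hK : 0 < K) (hκ : 0 < κ) :
    ∃ C A c : ℝ, 3 ≤ C ∧ 0 < A ∧ 0 < c ∧ ∀ (d n : ℕ), 0 < d → C * (d : ℝ) ≤ n →
      ∀ (M : Measure ℝ) [IsProbabilityMeasure M], IsCoordLaw M K κ →
      ∀ (ρ : Measure (EuclideanSpace ℝ (Fin n))) [IsProbabilityMeasure ρ] (R : ℝ), 0 < R →
      ∃ G : Set (EuclideanSpace ℝ (Fin n) × (Fin n → Fin d ⊕ Fin d → ℝ)), MeasurableSet G ∧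
        (ρ.prod (Measure.pi fun _ : Fin n => Measure.pi fun _ : Fin d ⊕ Fin d => M)).real Gᶜ
          ≤ 5 * Real.exp (-2 * d) ∧
        ∀ w ∈ G,
          (∀ p s : EuclideanSpace ℝ (Fin d ⊕ Fin d), ‖p‖ = 1 → ‖s‖ = 1 → inner ℝ p (rot s) = 0 →
            n * c ≤ ∑ k, |linForm p (w.2 k) * linForm s (w.2 k)
              + linForm (rot p) (w.2 k) * linForm (rot s) (w.2 k)|) ∧
          ((∀ k, |w.1 k| ≤ R) → ∀ p q,
            |covForm w.1 (∫ x, x ^ 2 ∂M) w.2 p q| ≤ A * R * √(n * d) * ‖p‖ * ‖q‖) := by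
  obtain ⟨c, C, hc, hC, hQ⟩ := exists_le_integral_abs_linForm_mul_add hK hκ
  have hg1 := one_le_gaussExpSq
  set A := 72 * K ^ 2 * (6 * gaussExpSq + 4) with hA
  have hAp : 0 < A := by positivity
  set D := K ^ 2 + 2 * A with hD
  have hDp : 0 < D := by positivity
  -- with this mesh, passing from the net to all pairs costs half of the lower bound `n c / 2`
  set δ := c / (16 * D) with hδ
  have hδp : 0 < δ := by positivity
  have hl : 0 < Real.log (1 + 2 / δ) := Real.log_pos (by
    have : 0 < 2 / δ := by positivity
    linarith)
  set c' := c ^ 2 / (8 * C) with hc'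
  have hc'p : 0 < c' := by positivity
  refine ⟨3 + (4 * Real.log (1 + 2 / δ) + 2) / c', 4 * A, c / 4, ?_, by positivity, by positivity,
    ?_⟩
  · have : 0 < (4 * Real.log (1 + 2 / δ) + 2) / c' := by positivity
    linarith
  intro d n hd hdn M _ h ρ _ R hR
  have hd1 : (1 : ℝ) ≤ d := by exact_mod_cast hd
  have hn3 : 3 * (d : ℝ) ≤ n := by
    refine le_trans ?_ hdn
    gcongr
    have : 0 < (4 * Real.log (1 + 2 / δ) + 2) / c' := by positivity
    linarith
  have hn0 : (0 : ℝ) < n := by linarith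
  have hn : 0 < n := by exact_mod_cast hn0
  have hc'n : (4 * Real.log (1 + 2 / δ) + 2) * d ≤ c' * n := by
    have h1 : (4 * Real.log (1 + 2 / δ) + 2) / c' * d ≤ n := by nlinarith
    calc (4 * Real.log (1 + 2 / δ) + 2) * d = c' * ((4 * Real.log (1 + 2 / δ) + 2) / c' * d) := by
          field_simp
      _ ≤ _ := by gcongr
  have hcard : (Fintype.card (Fin d ⊕ Fin d) : ℝ) = 2 * d := by
    simp
    ring
  have hmn : (Fintype.card (Fin d ⊕ Fin d) : ℝ) ≤ n := by rw [hcard]; linarith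
  set v := ∫ x, x ^ 2 ∂M with hv
  set ν1 := Measure.pi fun _ : Fin d ⊕ Fin d => M with hν1
  set ν := Measure.pi fun _ : Fin n => ν1 with hν
  -- a net of the unit sphere
  obtain ⟨N, hNS, hNcard, hNnet⟩ := exists_finite_net (E := EuclideanSpace ℝ (Fin d ⊕ Fin d))
    (show (0 : ℝ) < 1 / 4 by norm_num) {x | ‖x‖ = 1} (fun x hx => le_of_eq hx)
  have hN1 : ∀ p ∈ N, ‖p‖ = 1 := fun p hp => hNS hp
  rw [finrank_euclideanSpace, show (1 : ℝ) + 2 / (1 / 4) = 9 by norm_num] at hNcard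
  -- a net of the admissible pairs of unit vectors
  obtain ⟨P, hPS, hPcard, hPnet⟩ := exists_finite_net
    (E := EuclideanSpace ℝ (Fin d ⊕ Fin d) × EuclideanSpace ℝ (Fin d ⊕ Fin d)) hδp
    {x | ‖x.1‖ = 1 ∧ ‖x.2‖ = 1 ∧ inner ℝ x.1 (rot x.2) = 0}
    (fun x hx => by rw [Prod.norm_def, hx.1, hx.2.1]; simp)
  have hP : ∀ x ∈ P, ‖x.1‖ = 1 ∧ ‖x.2‖ = 1 ∧ inner ℝ x.1 (rot x.2) = 0 := fun x hx => hPS hx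
  rw [Module.finrank_prod, finrank_euclideanSpace] at hPcard
  -- the three exceptional events
  set B1 : Set (EuclideanSpace ℝ (Fin n) × (Fin n → Fin d ⊕ Fin d → ℝ)) :=
    {w | ∃ p ∈ N, A * 1 * √(n * Fintype.card (Fin d ⊕ Fin d)) <
      |∑ k : Fin n, 1 * (linForm p (w.2 k) ^ 2 - v)|} with hB1
  set B2 : Set (EuclideanSpace ℝ (Fin n) × (Fin n → Fin d ⊕ Fin d → ℝ)) :=
    {w | (∀ k, |w.1 k| ≤ R) ∧ ∃ p ∈ N, A * R * √(n * Fintype.card (Fin d ⊕ Fin d)) <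
      |∑ k : Fin n, w.1 k * (linForm p (w.2 k) ^ 2 - v)|} with hB2
  set B3 : Set (EuclideanSpace ℝ (Fin n) × (Fin n → Fin d ⊕ Fin d → ℝ)) :=
    {w | ∃ x ∈ P, ∑ k : Fin n, |linForm x.1 (w.2 k) * linForm x.2 (w.2 k)
      + linForm (rot x.1) (w.2 k) * linForm (rot x.2) (w.2 k)| ≤ n * (c / 2)} with hB3
  have mB1 : MeasurableSet B1 := by
    have : B1 = ⋃ p ∈ N, {w | A * 1 * √(n * Fintype.card (Fin d ⊕ Fin d)) <
        |∑ k : Fin n, 1 * (linForm p (w.2 k) ^ 2 - v)|} := by ext; simp [hB1]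
    rw [this]
    exact N.measurableSet_biUnion fun p _ => measurableSet_lt (by fun_prop) (by fun_prop)
  have mB2 : MeasurableSet B2 := by
    have : B2 = (⋂ k, {w | |w.1 k| ≤ R}) ∩
        ⋃ p ∈ N, {w | A * R * √(n * Fintype.card (Fin d ⊕ Fin d)) <
          |∑ k : Fin n, w.1 k * (linForm p (w.2 k) ^ 2 - v)|} := by ext; simp [hB2]
    rw [this]
    refine MeasurableSet.inter (MeasurableSet.iInter fun k => ?_)
      (N.measurableSet_biUnion fun p _ => ?_)
    · exact measurableSet_le (by fun_prop) (by fun_prop)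
    · exact measurableSet_lt (by fun_prop) (by fun_prop)
  have mB3 : MeasurableSet B3 := by
    have : B3 = ⋃ x ∈ P, {w | ∑ k : Fin n, |linForm x.1 (w.2 k) * linForm x.2 (w.2 k)
      + linForm (rot x.1) (w.2 k) * linForm (rot x.2) (w.2 k)| ≤ n * (c / 2)} := by
      ext; simp [hB3]
    rw [this]
    exact P.measurableSet_biUnion fun p _ => measurableSet_le (by fun_prop) (by fun_prop)
  have e2d : Real.exp (-(Fintype.card (Fin d ⊕ Fin d) : ℝ)) = Real.exp (-2 * d) := by
    rw [hcard]; ring_nf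
  have p1 : (ρ.prod ν).real B1 ≤ 2 * Real.exp (-2 * d) := by
    refine measureReal_prod_le mB1 (by positivity) fun a => ?_
    have := h.measureReal_exists_abs_sum_linForm_sq_gt_le hn hmn N hN1 hNcard
      (g := fun _ => 1) zero_lt_one (fun k => by simp)
    rw [e2d] at this
    exact this
  have p2 : (ρ.prod ν).real B2 ≤ 2 * Real.exp (-2 * d) := by
    refine measureReal_prod_le mB2 (by positivity) fun a => ?_
    by_cases ha : ∀ k, |a k| ≤ R
    · have := h.measureReal_exists_abs_sum_linForm_sq_gt_le hn hmn N hN1 hNcard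
        (g := a) hR ha
      rw [e2d] at this
      refine (measureReal_mono ?_).trans this
      intro r hr
      exact hr.2
    · have : Prod.mk a ⁻¹' B2 = ∅ := by
        ext r
        simp only [Set.mem_preimage, Set.mem_empty_iff_false, iff_false]
        exact fun hr => ha hr.1
      rw [this, measureReal_empty]
      positivity
  have p3 : (ρ.prod ν).real B3 ≤ Real.exp (-2 * d) := by
    refine measureReal_prod_le mB3 (by positivity) fun a => ?_
    have e : Prod.mk a ⁻¹' B3 = ⋃ x ∈ P, {r : Fin n → Fin d ⊕ Fin d → ℝ |
        ∑ k : Fin n, |linForm x.1 (r k) * linForm x.2 (r k)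
          + linForm (rot x.1) (r k) * linForm (rot x.2) (r k)| ≤ n * (c / 2)} := by
      ext; simp [hB3]
    rw [e]
    refine (measureReal_biUnion_finset_le _ _).trans ?_
    refine (Finset.sum_le_sum (g := fun _ => Real.exp (-c' * n)) fun x hx => ?_).trans ?_
    · obtain ⟨hx1, hx2, hx3⟩ := hP x hx
      obtain ⟨i1, i2, i3, i4⟩ := hQ M h _ x.1 x.2 (rot x.1) (rot x.2) hx1 hx2
        (by rw [norm_rot, hx1]) (by rw [norm_rot, hx2]) (inner_self_rot _) hx3
      have hind : iIndepFun (fun (k : Fin n) (r : Fin n → Fin d ⊕ Fin d → ℝ) =>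
          |linForm x.1 (r k) * linForm x.2 (r k)
            + linForm (rot x.1) (r k) * linForm (rot x.2) (r k)|) ν :=
        iIndepFun_pi (X := fun _ (y : Fin d ⊕ Fin d → ℝ) =>
          |linForm x.1 y * linForm x.2 y + linForm (rot x.1) y * linForm (rot x.2) y|)
          (fun k => by fun_prop)
      exact measureReal_sum_le_half_le hind (fun k => by fun_prop) (fun k ω => abs_nonneg _) hc hC
        (fun k => (measurePreserving_eval (fun _ : Fin n => ν1) k).integrable_comp_of_integrable i1)
        (fun k => (measurePreserving_eval (fun _ : Fin n => ν1) k).integrable_comp_of_integrable i2)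
        (fun k => by
          rw [integral_comp_eval (μ := fun _ : Fin n => ν1) (i := k)
            (f := fun y => |linForm x.1 y * linForm x.2 y
              + linForm (rot x.1) y * linForm (rot x.2) y|) i1.aestronglyMeasurable]
          exact i3)
        (fun k => by
          rw [integral_comp_eval (μ := fun _ : Fin n => ν1) (i := k)
            (f := fun y => |linForm x.1 y * linForm x.2 y
              + linForm (rot x.1) y * linForm (rot x.2) y| ^ 2) i2.aestronglyMeasurable]
          exact i4)
    · rw [Finset.sum_const, nsmul_eq_mul]
      have hcard' : (P.card : ℝ) ≤ Real.exp (4 * Real.log (1 + 2 / δ) * d) := by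
        refine hPcard.trans_eq ?_
        have hpos : 0 < 1 + 2 / δ := by positivity
        rw [show 4 * Real.log (1 + 2 / δ) * d =
            ((Fintype.card (Fin d ⊕ Fin d) + Fintype.card (Fin d ⊕ Fin d) : ℕ) : ℝ)
              * Real.log (1 + 2 / δ) by push_cast [hcard]; ring,
          Real.exp_nat_mul, Real.exp_log hpos]
      calc (P.card : ℝ) * Real.exp (-c' * n)
          ≤ Real.exp (4 * Real.log (1 + 2 / δ) * d) * Real.exp (-c' * n) := by gcongr
        _ ≤ Real.exp (-2 * d) := by
          rw [← Real.exp_add, Real.exp_le_exp]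
          linarith
  refine ⟨(B1 ∪ B2 ∪ B3)ᶜ, ((mB1.union mB2).union mB3).compl, ?_, ?_⟩
  · rw [compl_compl]
    have u1 := measureReal_union_le (μ := ρ.prod ν) (B1 ∪ B2) B3
    have u2 := measureReal_union_le (μ := ρ.prod ν) B1 B2
    linarith
  · intro w hw
    simp only [Set.mem_compl_iff, Set.mem_union, not_or] at hw
    obtain ⟨⟨hw1, hw2⟩, hw3⟩ := hw
    have hsq2 : √(n * Fintype.card (Fin d ⊕ Fin d)) ≤ 2 * √(n * d) := by
      rw [hcard, Real.sqrt_le_left (by positivity), mul_pow, Real.sq_sqrt (by positivity)]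
      nlinarith [mul_pos hn0 (show (0 : ℝ) < d by linarith)]
    have hsqn : √(n * Fintype.card (Fin d ⊕ Fin d)) ≤ n := by
      rw [Real.sqrt_le_left hn0.le]
      nlinarith
    have hv0 : 0 ≤ v := integral_nonneg fun x => sq_nonneg x
    have hvK : v ≤ K ^ 2 := h.integral_sq_le
    -- the empirical second moments are bounded by a multiple of `n`
    have hupper : ∀ p : EuclideanSpace ℝ (Fin d ⊕ Fin d),
        ∑ k, linForm p (w.2 k) ^ 2 ≤ (D * n) * ‖p‖ ^ 2 := by
      intro p
      have hb := abs_covForm_le_of_net (fun _ => 1) v w.2 N hN1 hNnet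
        (t := A * 1 * √(n * Fintype.card (Fin d ⊕ Fin d)))
        (fun p hp => not_lt.1 fun hlt => hw1 ⟨p, hp, hlt⟩) p p
      rw [covForm_apply, real_inner_self_eq_norm_sq] at hb
      simp only [one_mul, Finset.sum_sub_distrib, Finset.sum_const, Finset.card_univ,
        Fintype.card_fin, nsmul_eq_mul, ← sq] at hb
      have h1 := (abs_le.1 hb).2
      have h2 : 2 * (A * 1 * √(n * Fintype.card (Fin d ⊕ Fin d))) * ‖p‖ * ‖p‖
          ≤ 2 * (A * 1 * n) * ‖p‖ * ‖p‖ := by gcongr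
      have h3 : n * (v * ‖p‖ ^ 2) ≤ n * (K ^ 2 * ‖p‖ ^ 2) := by gcongr
      calc ∑ k, linForm p (w.2 k) ^ 2
          ≤ 2 * (A * 1 * n) * ‖p‖ * ‖p‖ + n * (K ^ 2 * ‖p‖ ^ 2) := by linarith
        _ = _ := by rw [hD]; ring
    refine ⟨fun p s hp hs hps => ?_, fun hb p q => ?_⟩
    · obtain ⟨x, hx, hxd⟩ := hPnet (p, s) ⟨hp, hs, hps⟩
      obtain ⟨hx1, hx2, hx3⟩ := hP x hx
      have hd1 : ‖p - x.1‖ ≤ δ := (norm_fst_le ((p, s) - x)).trans hxd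
      have hd2 : ‖s - x.2‖ ≤ δ := (norm_snd_le ((p, s) - x)).trans hxd
      have hlow : n * (c / 2) ≤ ∑ k : Fin n, |linForm x.1 (w.2 k) * linForm x.2 (w.2 k)
          + linForm (rot x.1) (w.2 k) * linForm (rot x.2) (w.2 k)| :=
        le_of_lt (not_le.1 fun hle => hw3 ⟨x, hx, hle⟩)
      have hpert := sum_abs_linForm_mul_add_ge (D := D * n) (by positivity) hupper hδp.le
        (p := p) (s := s) (p' := rot p) (s' := rot s) (q := x.1) (t := x.2) (q' := rot x.1)
        (t' := rot x.2) hs (by rw [norm_rot, hs]) hx1 (by rw [norm_rot, hx1]) hd1 hd2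
        (by rw [← rot_sub, norm_rot]; exact hd1) (by rw [← rot_sub, norm_rot]; exact hd2)
      have e : 4 * (D * n * δ) = n * (c / 4) := by
        rw [hδ]; field_simp; norm_num
      rw [e] at hpert
      linarith
    · have hb2 := abs_covForm_le_of_net w.1 v w.2 N hN1 hNnet
        (t := A * R * √(n * Fintype.card (Fin d ⊕ Fin d)))
        (fun p hp => not_lt.1 fun hlt => hw2 ⟨hb, p, hp, hlt⟩) p q
      refine hb2.trans ?_
      calc 2 * (A * R * √(n * Fintype.card (Fin d ⊕ Fin d))) * ‖p‖ * ‖q‖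
          ≤ 2 * (A * R * (2 * √(n * d))) * ‖p‖ * ‖q‖ := by gcongr
        _ = _ := by ring

/-! ### The empirical risk minimizer -/

/-- The real and imaginary parts of the coordinates of a vector in `ℂᵈ`. -/
def realVec {d : ℕ} (a : EuclideanSpace ℂ (Fin d)) : Fin d ⊕ Fin d → ℝ :=
  Sum.elim (fun i => (a i).re) (fun i => (a i).im)

/-- The vector of `realVec`, with the Euclidean norm. -/
noncomputable def realify {d : ℕ} (x : EuclideanSpace ℂ (Fin d)) :
    EuclideanSpace ℝ (Fin d ⊕ Fin d) :=
  WithLp.toLp 2 (realVec x)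

section

variable {d : ℕ}

theorem linForm_realify (a x : EuclideanSpace ℂ (Fin d)) :
    linForm (realify x) (realVec a) = (inner ℂ a x).re := by
  simp [linForm, realify, realVec, PiLp.inner_apply, Finset.sum_add_distrib]

theorem linForm_rot_realify (a x : EuclideanSpace ℂ (Fin d)) :
    linForm (rot (realify x)) (realVec a) = (inner ℂ a x).im := by
  simp [linForm, realify, realVec, rot, PiLp.inner_apply, Finset.sum_add_distrib, add_comm]

theorem inner_realify_rot (x y : EuclideanSpace ℂ (Fin d)) :
    inner ℝ (realify x) (rot (realify y)) = (inner ℂ x y).im := by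
  rw [← linForm_rot_realify]
  simp [linForm, realify, PiLp.inner_apply]

theorem norm_realify (x : EuclideanSpace ℂ (Fin d)) : ‖realify x‖ = ‖x‖ := by
  rw [← sq_eq_sq₀ (norm_nonneg _) (norm_nonneg _), EuclideanSpace.norm_sq_eq,
    EuclideanSpace.norm_sq_eq]
  simp only [Complex.sq_norm, Complex.normSq_apply, Fintype.sum_sum_type, realify, realVec,
    Sum.elim_inl, Sum.elim_inr, Real.norm_eq_abs, sq_abs, ← Finset.sum_add_distrib]
  exact Finset.sum_congr rfl fun i _ => by ring

/-- Polarisation of `|aᴴx|² - |aᴴy|²`. -/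
theorem norm_inner_sq_sub (a x y : EuclideanSpace ℂ (Fin d)) :
    ‖inner ℂ a x‖ ^ 2 - ‖inner ℂ a y‖ ^ 2 =
      linForm (realify (x - y)) (realVec a) * linForm (realify (x + y)) (realVec a)
      + linForm (rot (realify (x - y))) (realVec a) *
        linForm (rot (realify (x + y))) (realVec a) := by
  simp only [linForm_realify, linForm_rot_realify, inner_sub_right, inner_add_right,
    Complex.sq_norm, Complex.normSq_apply, Complex.sub_re, Complex.sub_im, Complex.add_re,
    Complex.add_im]
  ring

open scoped Matrix.Norms.Frobenius in
theorem norm_vecMulVec_star_le (x y : EuclideanSpace ℂ (Fin d)) :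
    ‖Matrix.vecMulVec x.ofLp (star y.ofLp)‖ ≤ ‖x‖ * ‖y‖ := by
  rw [Matrix.vecMulVec_eq Unit]
  refine (Matrix.frobenius_norm_mul _ _).trans ?_
  rw [Matrix.frobenius_norm_replicateCol, Matrix.frobenius_norm_replicateRow]
  have : ‖WithLp.toLp 2 (star y.ofLp)‖ = ‖y‖ := by
    simp [EuclideanSpace.norm_eq]
  rw [this]

open scoped Matrix.Norms.Frobenius in
/-- Polarisation: `xxᴴ - yyᴴ` is the Hermitian part of `(x - y)(x + y)ᴴ`. -/
theorem liftDist_le (x y : EuclideanSpace ℂ (Fin d)) : liftDist x y ≤ ‖x - y‖ * ‖x + y‖ := by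
  have e : Matrix.vecMulVec x.ofLp (star x.ofLp) - Matrix.vecMulVec y.ofLp (star y.ofLp) =
      (1 / 2 : ℂ) • (Matrix.vecMulVec (x - y).ofLp (star (x + y).ofLp)
        + Matrix.vecMulVec (x + y).ofLp (star (x - y).ofLp)) := by
    ext i j
    simp [Matrix.vecMulVec_apply]
    ring
  unfold liftDist
  rw [e, norm_smul]
  have h1 := norm_vecMulVec_star_le (x - y) (x + y)
  have h2 := norm_vecMulVec_star_le (x + y) (x - y)
  calc _ ≤ ‖(1 / 2 : ℂ)‖ * (‖x - y‖ * ‖x + y‖ + ‖x + y‖ * ‖x - y‖) := by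
        gcongr
        refine (norm_add_le _ _).trans ?_
        gcongr
    _ = _ := by
      rw [norm_div, norm_one, Complex.norm_ofNat]
      ring

theorem liftDist_smul (x y : EuclideanSpace ℂ (Fin d)) {c : ℂ} (hc : ‖c‖ = 1) :
    liftDist (c • x) y = liftDist x y := by
  unfold liftDist
  congr 2
  ext i j
  have h : c * star c = 1 := by
    rw [Complex.star_def, Complex.mul_conj, Complex.normSq_eq_norm_sq, hc]
    simp
  simp only [Matrix.vecMulVec_apply, WithLp.ofLp_smul, Pi.smul_apply,
    Pi.star_apply, smul_eq_mul, star_mul]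
  linear_combination (x i * star (x j)) * h

theorem exists_phase_im_inner_eq_zero (x y : EuclideanSpace ℂ (Fin d)) :
    ∃ c : ℂ, ‖c‖ = 1 ∧ (inner ℂ (c • x - y) (c • x + y)).im = 0 := by
  have key : ∀ c : ℂ, (inner ℂ (c • x) y).im = 0 → (inner ℂ (c • x - y) (c • x + y)).im = 0 := by
    intro c h
    have h1 : (inner ℂ y (c • x)).im = 0 := by
      rw [← inner_conj_symm, Complex.conj_im, h, neg_zero]
    have h2 : ∀ z : EuclideanSpace ℂ (Fin d), (inner ℂ z z).im = 0 := fun z =>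
      inner_self_im (𝕜 := ℂ) z
    simp only [inner_sub_left, inner_add_right, Complex.sub_im, Complex.add_im, h, h1, h2]
    simp
  by_cases hz : inner ℂ x y = 0
  · exact ⟨1, by simp, key 1 (by simp [hz])⟩
  · refine ⟨inner ℂ x y / ‖inner ℂ x y‖, ?_, key _ ?_⟩
    · rw [norm_div, Complex.norm_real, norm_norm, div_self (norm_ne_zero_iff.2 hz)]
    · rw [inner_smul_left, map_div₀, Complex.conj_ofReal, div_mul_eq_mul_div, mul_comm,
        Complex.mul_conj]
      rw [← Complex.ofReal_div, Complex.ofReal_im]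

/-- The deterministic error bound. With `Qₖ = |aₖᴴx̂|² - |aₖᴴx₀|²`, minimality of `x̂` gives
`∑ Qₖ² ≤ 2 ∑ ηₖ Qₖ`; after multiplying `x̂` by a phase, the left-hand side is at least
`n c² (‖x̂ - x₀‖ ‖x̂ + x₀‖)²` and the right-hand side is at most a multiple of
`‖x̂ - x₀‖ ‖x̂ + x₀‖`. -/
theorem liftDist_le_of_isERM {n : ℕ} (hn : 0 < n) {a : Fin n → EuclideanSpace ℂ (Fin d)}
    {η : EuclideanSpace ℝ (Fin n)} {x₀ xhat : EuclideanSpace ℂ (Fin d)} {c T S v : ℝ}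
    (hc : 0 < c) (hT : 0 ≤ T) (hv : 0 ≤ v)
    (hlow : ∀ p s : EuclideanSpace ℝ (Fin d ⊕ Fin d), ‖p‖ = 1 → ‖s‖ = 1 → inner ℝ p (rot s) = 0 →
      n * c ≤ ∑ k, |linForm p (realVec (a k)) * linForm s (realVec (a k))
        + linForm (rot p) (realVec (a k)) * linForm (rot s) (realVec (a k))|)
    (hnoise : ∀ p q, |covForm η v (fun k => realVec (a k)) p q| ≤ T * ‖p‖ * ‖q‖)
    (hsum : |∑ k, η k| ≤ S) (herm : IsERM a (nprData a x₀ η) xhat) :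
    liftDist xhat x₀ ≤ 4 * (T + v * S) / (n * c ^ 2) := by
  have hn' : (0 : ℝ) < n := by exact_mod_cast hn
  have hS : 0 ≤ S := (abs_nonneg _).trans hsum
  obtain ⟨z, hz, him⟩ := exists_phase_im_inner_eq_zero xhat x₀
  rw [← liftDist_smul xhat x₀ hz]
  set x := z • xhat with hx
  refine (liftDist_le x x₀).trans ?_
  set p := realify (x - x₀) with hp
  set s := realify (x + x₀) with hs
  rw [← norm_realify (x - x₀), ← norm_realify (x + x₀), ← hp, ← hs]
  rcases eq_or_ne p 0 with hp0 | hp0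
  · rw [hp0, norm_zero, zero_mul]
    positivity
  rcases eq_or_ne s 0 with hs0 | hs0
  · rw [hs0, norm_zero, mul_zero]
    positivity
  have hpn : 0 < ‖p‖ := norm_pos_iff.2 hp0
  have hsn : 0 < ‖s‖ := norm_pos_iff.2 hs0
  set W := ‖p‖ * ‖s‖ with hW
  have hWp : 0 < W := mul_pos hpn hsn
  set Q : Fin n → ℝ := fun k => linForm p (realVec (a k)) * linForm s (realVec (a k))
        + linForm (rot p) (realVec (a k)) * linForm (rot s) (realVec (a k)) with hQ
  have hQeq : ∀ k, Q k = ‖inner ℂ (a k) xhat‖ ^ 2 - ‖inner ℂ (a k) x₀‖ ^ 2 := by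
    intro k
    have : ‖inner ℂ (a k) xhat‖ = ‖inner ℂ (a k) x‖ := by
      rw [hx, inner_smul_right, norm_mul, hz, one_mul]
    rw [this, norm_inner_sq_sub]
  have hQlow : n * c * W ≤ ∑ k, |Q k| := by
    have hunit : ∀ y : EuclideanSpace ℝ (Fin d ⊕ Fin d), y ≠ 0 → ‖(‖y‖⁻¹ • y)‖ = 1 :=
      fun y hy => by rw [norm_smul, norm_inv, norm_norm, inv_mul_cancel₀ (norm_ne_zero_iff.2 hy)]
    have h0 : inner ℝ (‖p‖⁻¹ • p) (rot (‖s‖⁻¹ • s)) = 0 := by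
      rw [rot_smul, real_inner_smul_left, real_inner_smul_right, inner_realify_rot, him]
      simp
    have h1 := hlow _ _ (hunit p hp0) (hunit s hs0) h0
    have e : ∀ k, |linForm (‖p‖⁻¹ • p) (realVec (a k)) * linForm (‖s‖⁻¹ • s) (realVec (a k))
        + linForm (rot (‖p‖⁻¹ • p)) (realVec (a k)) * linForm (rot (‖s‖⁻¹ • s)) (realVec (a k))|
        = W⁻¹ * |Q k| := by
      intro k
      rw [← abs_of_pos (inv_pos.2 hWp), ← abs_mul]
      congr 1
      simp only [rot_smul, linForm_smul, hQ, hW]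
      field_simp
    simp_rw [e, ← Finset.mul_sum] at h1
    rwa [inv_mul_eq_div, le_div_iff₀ hWp] at h1
  have hbasic : ∑ k, Q k ^ 2 ≤ 2 * ∑ k, η k * Q k := by
    have h1 := herm x₀
    unfold nprLoss nprData at h1
    have e1 : ∀ k, (‖inner ℂ (a k) x₀‖ ^ 2 + η k - ‖inner ℂ (a k) xhat‖ ^ 2) ^ 2 =
        η k ^ 2 - 2 * (η k * Q k) + Q k ^ 2 := fun k => by rw [hQeq]; ring
    have e2 : ∀ k, (‖inner ℂ (a k) x₀‖ ^ 2 + η k - ‖inner ℂ (a k) x₀‖ ^ 2) ^ 2 = η k ^ 2 :=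
      fun k => by ring
    simp only [e1, e2, Finset.sum_add_distrib, Finset.sum_sub_distrib, ← Finset.mul_sum] at h1
    linarith
  have hup : ∑ k, η k * Q k ≤ 2 * (T + v * S) * W := by
    have e : ∑ k, η k * Q k = covForm η v (fun k => realVec (a k)) p s
        + covForm η v (fun k => realVec (a k)) (rot p) (rot s)
        + 2 * (v * inner ℝ p s) * ∑ k, η k := by
      simp only [covForm_apply, inner_rot_rot, Finset.mul_sum, ← Finset.sum_add_distrib, hQ]
      exact Finset.sum_congr rfl fun k _ => by ring
    have h1 := (abs_le.1 (hnoise p s)).2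
    have h2 := (abs_le.1 (hnoise (rot p) (rot s))).2
    rw [norm_rot, norm_rot] at h2
    have h3 : 2 * (v * inner ℝ p s) * ∑ k, η k ≤ 2 * (v * W) * S := by
      refine (le_abs_self _).trans ?_
      rw [abs_mul, abs_mul, abs_mul, abs_of_nonneg hv, abs_two]
      have := abs_real_inner_le_norm p s
      gcongr
    rw [e]
    calc _ ≤ T * ‖p‖ * ‖s‖ + T * ‖p‖ * ‖s‖ + 2 * (v * W) * S := by linarith
      _ = _ := by rw [hW]; ring
  have hcs : (∑ k, |Q k|) ^ 2 ≤ n * ∑ k, Q k ^ 2 := by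
    have := sq_sum_le_card_mul_sum_sq (s := Finset.univ) (f := fun k => |Q k|)
    simpa using this
  have hfin : (n * c * W) ^ 2 ≤ n * (2 * (2 * (T + v * S) * W)) := by
    calc (n * c * W) ^ 2 ≤ (∑ k, |Q k|) ^ 2 := by gcongr
      _ ≤ n * ∑ k, Q k ^ 2 := hcs
      _ ≤ _ := by gcongr; linarith
  rw [le_div_iff₀ (by positivity)]
  refine le_of_mul_le_mul_left ?_ (mul_pos hn' hWp)
  calc n * W * (W * (n * c ^ 2)) = (n * c * W) ^ 2 := by ring
    _ ≤ _ := hfin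
    _ = _ := by ring

end

/-! ### Tails of the noise and the error bounds -/

theorem IsMeasurementEnsemble.map_realVec {Ω : Type*} [MeasurableSpace Ω] {d n : ℕ}
    {M : Measure ℝ} [IsProbabilityMeasure M] {α : Fin n → Ω → EuclideanSpace ℂ (Fin d)}
    {μ : Measure Ω} [IsProbabilityMeasure μ] (h : IsMeasurementEnsemble M α μ) :
    μ.map (fun ω k => realVec (α k ω)) =
      Measure.pi fun _ : Fin n => Measure.pi fun _ : Fin d ⊕ Fin d => M := by
  have hmeas := h.measurable
  have hrv : Measurable (realVec : EuclideanSpace ℂ (Fin d) → Fin d ⊕ Fin d → ℝ) := by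
    refine measurable_pi_lambda _ fun i => ?_
    rcases i with i | i <;> simp only [realVec, Sum.elim_inl, Sum.elim_inr] <;> fun_prop
  have hind : iIndepFun (fun k ω => realVec (α k ω)) μ :=
    h.indep.comp (fun _ => realVec) (fun _ => hrv)
  rw [hind.map_fun_eq_pi_map (f := fun k ω => realVec (α k ω))
    fun k => (hrv.comp (hmeas k)).aemeasurable]
  congr 1
  funext k
  have e : (fun ω => realVec (α k ω)) = fun ω i => realCoords (α k) i ω := by
    funext ω i
    rcases i with i | i <;> rfl
  have hc : ∀ i, AEMeasurable (realCoords (α k) i) μ := fun i => by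
    have := (measurable_pi_apply i).comp (hrv.comp (hmeas k))
    refine Measurable.aemeasurable ?_
    rcases i with i | i <;> exact this
  rw [e, (h.indep_coords k).map_fun_eq_pi_map hc]
  congr 1
  funext i
  exact h.law_coords k i

theorem HoldsWithProb.mono {Ω : Type*} [MeasurableSpace Ω] {μ : Measure Ω} {p q : ℝ}
    {P P' : Ω → Prop} (h : HoldsWithProb μ p P) (hq : q ≤ p) (hP : ∀ ω, P ω → P' ω) :
    HoldsWithProb μ q P' := by
  obtain ⟨E, h1, h2, h3⟩ := h
  exact ⟨E, h1, hq.trans h2, fun ω hω => hP ω (h3 ω hω)⟩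

/-- The error bound in terms of the level `R` of the largest noise coordinate and the level
`S √(n d)` of the sum of the noise coordinates. -/
theorem exists_holdsWithProb_liftDist_le {K κ : ℝ} (hK : 0 < K) (hκ : 0 < κ) :
    ∃ C A : ℝ, 3 ≤ C ∧ 0 < A ∧ ∀ (d n : ℕ), 0 < d → C * (d : ℝ) ≤ n →
      ∀ (Ω : Type*) [MeasurableSpace Ω] (μ : Measure Ω) [IsProbabilityMeasure μ]
        (M : Measure ℝ) [IsProbabilityMeasure M]
        (α : Fin n → Ω → EuclideanSpace ℂ (Fin d)) (η : Ω → EuclideanSpace ℝ (Fin n)),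
        IsCoordLaw M K κ → IsMeasurementEnsemble M α μ → Measurable η →
        IndepFun η (fun ω k => α k ω) μ → ∀ R S p₁ p₂ : ℝ, 0 < R → 0 ≤ S →
        μ.real {ω | ∃ k, R < |η ω k|} ≤ p₁ → μ.real {ω | S * √(n * d) < |∑ k, η ω k|} ≤ p₂ →
        HoldsWithProb μ (1 - 5 * Real.exp (-2 * d) - p₁ - p₂) fun ω =>
          ∀ x₀ xhat : EuclideanSpace ℂ (Fin d),
            IsERM (fun k => α k ω) (nprData (fun k => α k ω) x₀ (η ω)) xhat →
            liftDist xhat x₀ ≤ A * (R + S) * √(d / n) := by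
  obtain ⟨C, A, c, hC, hA, hc, hgood⟩ := exists_good_event hK hκ
  refine ⟨C, 4 * (A + K ^ 2) / c ^ 2, hC, by positivity, ?_⟩
  intro d n hd hdn Ω _ μ _ M _ α η hM hα hη hind R S p₁ p₂ hR hS hp₁ hp₂
  have hd1 : (1 : ℝ) ≤ d := by exact_mod_cast hd
  have hn0 : (0 : ℝ) < n := by nlinarith
  have hn : 0 < n := by exact_mod_cast hn0
  have hmeas := hα.measurable
  have hrv : Measurable fun (x : Fin n → EuclideanSpace ℂ (Fin d)) k => realVec (x k) := by
    refine measurable_pi_lambda _ fun k => measurable_pi_lambda _ fun i => ?_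
    rcases i with i | i <;> simp only [realVec, Sum.elim_inl, Sum.elim_inr] <;> fun_prop
  have hr : Measurable fun ω k => realVec (α k ω) :=
    hrv.comp (measurable_pi_lambda _ fun k => hmeas k)
  have : IsProbabilityMeasure (μ.map η) := Measure.isProbabilityMeasure_map hη.aemeasurable
  obtain ⟨G, hG, hGp, hGprop⟩ := hgood d n hd hdn M hM (μ.map η) R hR
  have hmap : μ.map (fun ω => (η ω, fun k => realVec (α k ω))) =
      (μ.map η).prod (Measure.pi fun _ : Fin n => Measure.pi fun _ : Fin d ⊕ Fin d => M) := by
    have hi : IndepFun η (fun ω k => realVec (α k ω)) μ := hind.comp measurable_id hrv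
    rw [(indepFun_iff_map_prod_eq_prod_map_map hη.aemeasurable hr.aemeasurable).1 hi,
      hα.map_realVec]
  set Φ : Ω → EuclideanSpace ℝ (Fin n) × (Fin n → Fin d ⊕ Fin d → ℝ) :=
    fun ω => (η ω, fun k => realVec (α k ω)) with hΦ
  have hΦm : Measurable Φ := hη.prodMk hr
  have hb0 : μ.real (Φ ⁻¹' Gᶜ) ≤ 5 * Real.exp (-2 * d) := by
    rw [← hmap, measureReal_def, Measure.map_apply hΦm hG.compl] at hGp
    exact hGp
  have m1 : MeasurableSet {ω | ∃ k, R < |η ω k|} := by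
    have : {ω | ∃ k, R < |η ω k|} = ⋃ k, {ω | R < |η ω k|} := by ext; simp
    rw [this]
    exact MeasurableSet.iUnion fun k => measurableSet_lt (by fun_prop) (by fun_prop)
  have m2 : MeasurableSet {ω | S * √(n * d) < |∑ k, η ω k|} :=
    measurableSet_lt (by fun_prop) (by fun_prop)
  refine ⟨(Φ ⁻¹' Gᶜ ∪ {ω | ∃ k, R < |η ω k|} ∪ {ω | S * √(n * d) < |∑ k, η ω k|})ᶜ,
    (((hΦm hG.compl).union m1).union m2).compl, ?_, ?_⟩
  · rw [probReal_compl_eq_one_sub (((hΦm hG.compl).union m1).union m2)]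
    have u1 := measureReal_union_le (μ := μ) (Φ ⁻¹' Gᶜ ∪ {ω | ∃ k, R < |η ω k|})
      {ω | S * √(n * d) < |∑ k, η ω k|}
    have u2 := measureReal_union_le (μ := μ) (Φ ⁻¹' Gᶜ) {ω | ∃ k, R < |η ω k|}
    linarith
  · intro ω hω x₀ xhat herm
    simp only [Set.mem_compl_iff, Set.mem_union, not_or, Set.mem_preimage, not_not,
      Set.mem_ofPred_eq, not_exists, not_lt] at hω
    obtain ⟨⟨hωG, hω1⟩, hω2⟩ := hω
    obtain ⟨hlow, hnoise⟩ := hGprop _ hωG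
    have hv0 : 0 ≤ ∫ x, x ^ 2 ∂M := integral_nonneg fun x => sq_nonneg x
    have hmain := liftDist_le_of_isERM hn hc (T := A * R * √(n * d)) (by positivity) hv0 hlow
      (hnoise hω1) hω2 herm
    refine hmain.trans ?_
    have hsq : √((n : ℝ) * d) = n * √(d / n) := by
      rw [show (n : ℝ) * d = n ^ 2 * (d / n) by field_simp, Real.sqrt_mul (by positivity),
        Real.sqrt_sq hn0.le]
    rw [div_le_iff₀ (by positivity), hsq]
    calc 4 * (A * R * (n * √(d / n)) + (∫ x, x ^ 2 ∂M) * (S * (n * √(d / n))))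
        ≤ 4 * (A * R * (n * √(d / n)) + K ^ 2 * (S * (n * √(d / n)))) := by
          gcongr
          exact hM.integral_sq_le
      _ ≤ 4 * ((A + K ^ 2) * R * (n * √(d / n)) + (A + K ^ 2) * (S * (n * √(d / n)))) := by
          have : 0 ≤ K ^ 2 := sq_nonneg K
          gcongr <;> linarith
      _ = _ := by field_simp

theorem measureReal_le_exp_of_integral_exp_le {Ω : Type*} [MeasurableSpace Ω] {μ : Measure Ω}
    [IsProbabilityMeasure μ] {f : Ω → ℝ} {s : Set Ω} {t : ℝ}
    (hi : Integrable (fun ω => Real.exp (f ω)) μ) (h2 : ∫ ω, Real.exp (f ω) ∂μ ≤ 2)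
    (hs : ∀ ω ∈ s, t ≤ f ω) : μ.real s ≤ 2 * Real.exp (-t) := by
  have h := mul_meas_ge_le_integral_of_nonneg
    (Filter.Eventually.of_forall fun ω => (Real.exp_pos (f ω)).le) hi (Real.exp t)
  have h1 : μ.real s ≤ μ.real {ω | Real.exp t ≤ Real.exp (f ω)} :=
    measureReal_mono fun ω hω => Real.exp_le_exp.2 (hs ω hω)
  rw [Real.exp_neg, ← div_eq_mul_inv, le_div_iff₀ (Real.exp_pos t)]
  nlinarith [Real.exp_pos t]

/-- Union bound for the largest of `n` variables, each of which exceeds `R` with probability at most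
`2 n ^ (-(j + 1))`. -/
theorem measureReal_exists_lt_le {Ω : Type*} [MeasurableSpace Ω] {μ : Measure Ω}
    [IsProbabilityMeasure μ] {n : ℕ} (hn : 0 < n) {X : Fin n → Ω → ℝ} {f : Fin n → Ω → ℝ}
    {R : ℝ} {j : ℕ} (hi : ∀ k, Integrable (fun ω => Real.exp (f k ω)) μ)
    (h2 : ∀ k, ∫ ω, Real.exp (f k ω) ∂μ ≤ 2)
    (hs : ∀ k ω, R < |X k ω| → (j + 1 : ℕ) * Real.log n ≤ f k ω) :
    μ.real {ω | ∃ k, R < |X k ω|} ≤ 2 / (n : ℝ) ^ j := by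
  have hn' : (0 : ℝ) < n := by exact_mod_cast hn
  have e : {ω | ∃ k, R < |X k ω|} = ⋃ k ∈ Finset.univ, {ω | R < |X k ω|} := by ext; simp
  rw [e]
  refine (measureReal_biUnion_finset_le _ _).trans ?_
  refine (Finset.sum_le_sum fun k _ =>
    measureReal_le_exp_of_integral_exp_le (hi k) (h2 k) (hs k)).trans ?_
  rw [Finset.sum_const, Finset.card_univ, Fintype.card_fin, nsmul_eq_mul, Real.exp_neg,
    Real.exp_nat_mul, Real.exp_log hn']
  refine le_of_eq ?_
  field_simp
  ring

theorem mainTheorem3 (K κ L : ℝ) (hK : 0 < K) (hκ : 0 < κ) (hL : 0 < L) :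
    ∃ C₁ C₂ C₃ C₄ C₅ : ℝ, 0 < C₁ ∧ 0 < C₂ ∧ 0 < C₃ ∧ 0 < C₄ ∧ 0 < C₅ ∧
      ∀ (d n : ℕ), 0 < d → C₁ * (d : ℝ) ≤ (n : ℝ) →
      ∀ (Ω : Type*) [MeasurableSpace Ω] (μ : Measure Ω) [IsProbabilityMeasure μ]
        (M : Measure ℝ) [IsProbabilityMeasure M]
        (α : Fin n → Ω → EuclideanSpace ℂ (Fin d)) (η : Ω → EuclideanSpace ℝ (Fin n)),
        -- the law of the coordinates of the measurement vectors
        ∫ x, x ∂M = 0 →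
        psi2Norm (fun x : ℝ => x) M ≤ ENNReal.ofReal K →
        (∫ x, x ^ 2 ∂M) ^ 2 + κ ≤ ∫ x, x ^ 4 ∂M →
        IsMeasurementEnsemble M α μ →
        -- zero-mean noise, independent of the measurement vectors
        Measurable η →
        IndepFun η (fun ω k => α k ω) μ →
        (∀ k, ∫ ω, η ω k ∂μ = 0) →
        -- (a) sub-Gaussian noise vector
        (psi2NormVec η μ ≤ ENNReal.ofReal L →
          HoldsWithProb μ (1 - C₃ * Real.exp (-C₄ * d) - 2 / (n : ℝ) ^ 49) fun ω =>
            ∀ x₀ xhat : EuclideanSpace ℂ (Fin d),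
              IsERM (fun k => α k ω) (nprData (fun k => α k ω) x₀ (η ω)) xhat →
              liftDist xhat x₀ ≤ C₂ * √(d * Real.log n / n)) ∧
        -- (b) independent sub-exponential noise
        (iIndepFun (fun k ω => η ω k) μ →
          (∀ k, psi1Norm (fun ω => η ω k) μ ≤ ENNReal.ofReal L) →
          HoldsWithProb μ (1 - C₃ * Real.exp (-C₄ * d) - 2 / (n : ℝ) ^ 9) fun ω =>
            ∀ x₀ xhat : EuclideanSpace ℂ (Fin d),
              IsERM (fun k => α k ω) (nprData (fun k => α k ω) x₀ (η ω)) xhat →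
              liftDist xhat x₀ ≤ C₅ * √(d * Real.log n ^ 2 / n)) := by
  -- the infima in the `ψ`-norms need not be attained, whence the factor `2` in `2 * K` and `2 * L`
  obtain ⟨C, A, hC, hA, hmain⟩ := exists_holdsWithProb_liftDist_le (K := 2 * K) (by positivity) hκ
  refine ⟨C, A * (20 * L), 7, 2, A * (60 * L), by linarith, by positivity, by norm_num,
    by norm_num, by positivity, ?_⟩
  intro d n hd hdn Ω _ μ _ M _ α η hM0 hM2 hM4 hα hη hind hη0
  have hM : IsCoordLaw M (2 * K) κ := by
    obtain ⟨h1, h2⟩ := integrable_exp_sq_of_psi2Norm_le (by fun_prop) hK hM2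
    exact ⟨by positivity, hκ, hM0, h1, h2, hM4⟩
  have hd1 : (1 : ℝ) ≤ d := by exact_mod_cast hd
  have hn3 : (3 : ℝ) ≤ n := by nlinarith
  have hn0 : (0 : ℝ) < n := by linarith
  have hn : 0 < n := by exact_mod_cast hn0
  have hlog : 1 ≤ Real.log n := by
    rw [Real.le_log_iff_exp_le hn0]
    linarith [Real.exp_one_lt_d9]
  have hdn2 : 2 * (d : ℝ) ≤ n := by nlinarith
  have hcore := hmain d n hd hdn Ω μ M α η hM hα hη hind
  constructor
  · intro hvec
    have hψ : ∀ w : EuclideanSpace ℝ (Fin n), ‖w‖ = 1 →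
        Integrable (fun ω => Real.exp (inner ℝ w (η ω) ^ 2 / (2 * L) ^ 2)) μ ∧
          ∫ ω, Real.exp (inner ℝ w (η ω) ^ 2 / (2 * L) ^ 2) ∂μ ≤ 2 := fun w hw =>
      integrable_exp_sq_of_psi2Norm_le (by fun_prop) hL
        ((le_iSup₂ (f := fun (w : EuclideanSpace ℝ (Fin n)) (_ : ‖w‖ = 1) =>
          psi2Norm (fun ω => inner ℝ w (η ω)) μ) w hw).trans hvec)
    -- at this level each of the `n` coordinates has a tail of at most `2 n ^ (-50)`
    have hp₁ : μ.real {ω | ∃ k, 2 * L * √(50 * Real.log n) < |η ω k|} ≤ 2 / (n : ℝ) ^ 49 := by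
      refine measureReal_exists_lt_le hn (X := fun k ω => η ω k)
        (f := fun k ω => η ω k ^ 2 / (2 * L) ^ 2) (fun k => ?_) (fun k => ?_)
        (fun k ω hlt => ?_)
      · simpa [EuclideanSpace.inner_single_left] using (hψ (EuclideanSpace.single k 1) (by simp)).1
      · simpa [EuclideanSpace.inner_single_left] using (hψ (EuclideanSpace.single k 1) (by simp)).2
      · rw [le_div_iff₀ (by positivity), ← sq_abs (η ω k)]
        calc ((49 + 1 : ℕ) : ℝ) * Real.log n * (2 * L) ^ 2
            = (2 * L * √(50 * Real.log n)) ^ 2 := by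
              rw [mul_pow (2 * L), Real.sq_sqrt (by positivity)]
              push_cast
              ring
          _ ≤ _ := by gcongr
    have hp₂ : μ.real {ω | 4 * L * √(n * d) < |∑ k, η ω k|} ≤ 2 * Real.exp (-(2 * d)) := by
      -- the direction `n^{-1/2} (1, …, 1)`
      set w : EuclideanSpace ℝ (Fin n) := WithLp.toLp 2 fun _ => (√(n : ℝ))⁻¹ with hw
      have hw1 : ‖w‖ = 1 := by
        rw [EuclideanSpace.norm_eq, Real.sqrt_eq_one]
        simp only [hw, Real.norm_eq_abs, sq_abs, inv_pow, Real.sq_sqrt hn0.le, Finset.sum_const,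
          Finset.card_univ, Fintype.card_fin, nsmul_eq_mul]
        exact mul_inv_cancel₀ hn0.ne'
      have hin : ∀ ω, inner ℝ w (η ω) = (√(n : ℝ))⁻¹ * ∑ k, η ω k := fun ω => by
        simp only [PiLp.inner_apply, hw, Finset.mul_sum, Real.inner_apply]
      obtain ⟨i1, i2⟩ := hψ w hw1
      refine measureReal_le_exp_of_integral_exp_le i1 i2 fun ω hω => ?_
      rw [Set.mem_ofPred_eq] at hω
      have h1 : (4 * L * √(n * d)) ^ 2 ≤ (∑ k, η ω k) ^ 2 := by
        rw [← sq_abs (∑ k, η ω k)]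
        gcongr
      rw [mul_pow, Real.sq_sqrt (by positivity)] at h1
      rw [hin, mul_pow, inv_pow, Real.sq_sqrt hn0.le, le_div_iff₀ (by positivity),
        inv_mul_eq_div, le_div_iff₀ hn0]
      have : 0 < L ^ 2 * (n * d) := by positivity
      nlinarith
    refine (hcore (2 * L * √(50 * Real.log n)) (4 * L) _ _ (by positivity) (by positivity)
      hp₁ hp₂).mono ?_ fun ω h x₀ xhat herm => (h x₀ xhat herm).trans ?_
    · rw [neg_mul]
      linarith
    · have h50 : √(50 * Real.log n) ≤ 8 * √(Real.log n) := by
        rw [Real.sqrt_le_left (by positivity), mul_pow, Real.sq_sqrt (by positivity)]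
        linarith
      have h1 : 1 ≤ √(Real.log n) := Real.one_le_sqrt.2 hlog
      have hRS : 2 * L * √(50 * Real.log n) + 4 * L ≤ 20 * L * √(Real.log n) := by
        have h2 := mul_le_mul_of_nonneg_left h50 hL.le
        have h3 := mul_le_mul_of_nonneg_left h1 hL.le
        linarith
      calc A * (2 * L * √(50 * Real.log n) + 4 * L) * √(d / n)
          ≤ A * (20 * L * √(Real.log n)) * √(d / n) := by gcongr
        _ = A * (20 * L) * √(d * Real.log n / n) := by
          rw [show (d : ℝ) * Real.log n / n = Real.log n * (d / n) by ring,
            Real.sqrt_mul (by positivity)]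
          ring
  · intro hiind hψ1
    have hηk : ∀ k, Measurable fun ω => η ω k := fun k => by fun_prop
    have hψ := fun k => integrable_exp_abs_of_psi1Norm_le (hηk k).aemeasurable hL (hψ1 k)
    -- at this level each of the `n` coordinates has a tail of at most `2 n ^ (-10)`
    have hp₁ : μ.real {ω | ∃ k, 20 * L * Real.log n < |η ω k|} ≤ 2 / (n : ℝ) ^ 9 := by
      refine measureReal_exists_lt_le hn (X := fun k ω => η ω k)
        (f := fun k ω => |η ω k| / (2 * L)) (fun k => (hψ k).1) (fun k => (hψ k).2)
        (fun k ω hlt => ?_)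
      rw [le_div_iff₀ (by positivity)]
      push_cast
      linarith
    have hp₂ : μ.real {ω | 40 * L * √(n * d) < |∑ k, η ω k|} ≤ 2 * Real.exp (-(2 * d)) := by
      have hb := measureReal_abs_weighted_sum_gt_le hn hiind hηk (b := 2 * L) (by positivity)
        (fun k => (hψ k).1) (fun k => (hψ k).2) hη0 (h := fun _ => 1) (R := 1) zero_lt_one
        (fun k => by simp) (m := 2 * d) (by positivity) hdn2 (20 * L)
      have hsq : √((n : ℝ) * (2 * d)) ≤ 2 * √(n * d) := by
        rw [Real.sqrt_le_left (by positivity), mul_pow, Real.sq_sqrt (by positivity)]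
        have : 0 < (n : ℝ) * d := by positivity
        nlinarith
      refine (measureReal_mono fun ω hω => ?_).trans (hb.trans_eq ?_)
      · rw [Set.mem_ofPred_eq] at hω ⊢
        simp only [one_mul, mul_one]
        refine lt_of_le_of_lt ?_ hω
        calc 20 * L * √(n * (2 * d)) ≤ 20 * L * (2 * √(n * d)) := by gcongr
          _ = _ := by ring
      · congr 2
        field_simp
        ring
    refine (hcore (20 * L * Real.log n) (40 * L) _ _ (by positivity) (by positivity)
      hp₁ hp₂).mono ?_ fun ω h x₀ xhat herm => (h x₀ xhat herm).trans ?_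
    · rw [neg_mul]
      linarith
    · have hRS : 20 * L * Real.log n + 40 * L ≤ 60 * L * Real.log n := by
        have := mul_le_mul_of_nonneg_left hlog hL.le
        linarith
      calc A * (20 * L * Real.log n + 40 * L) * √(d / n)
          ≤ A * (60 * L * Real.log n) * √(d / n) := by gcongr
        _ = A * (60 * L) * √(d * Real.log n ^ 2 / n) := by
          rw [show (d : ℝ) * Real.log n ^ 2 / n = Real.log n ^ 2 * (d / n) by ring,
            Real.sqrt_mul (by positivity), Real.sqrt_sq (by linarith)]
          ring
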